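/- Let $N\ge 1$, $k\in\mathbb Z$ (only its class mod $N$ matters), $a\in\mathbb R$, $s=e^{2\pi i/N}$, and let $q\in L^2(0,1)$ be real. In $L^2(\Gamma)=\bigoplus_{(n,j)\in\mathbb Z\times\{0,1,2\}}L^2(0,1)$ let $H_k(a)$ be the operator $(H_kf)_{n,j}=-f_{n,j}''+qf_{n,j}$, whose domain $\mathfrak D(H_k)$ consists of all $f=(f_{n,j})$ such that each $f_{n,j}$ is $C^1$ on $[0,1]$ with absolutely continuous derivative, $f,f''\in L^2(\Gamma)$, and for all $n\in\mathbb Z$ $$f_{n,0}(1)=f_{n,1}(0)=e^{ia}s^kf_{n,2}(1),\qquad f_{n+1,0}(0)=e^{ia}f_{n,1}(1)=f_{n,2}(0),$$ $$-f_{n,0}'(1)+f_{n,1}'(0)-e^{ia}s^kf_{n,2}'(1)=0,\qquad f_{n+1,0}'(0)-e^{ia}f_{n,1}'(1)+f_{n,2}'(0)=0.$$ Let $\mathcal H_k(\lambda)=\{\psi\in\mathfrak D(H_k):H_k\psi=\lambda\psi\}$, with the norm of $L^2(\Gamma)$, and let $\sigma_\infty(H_k)$ be the set of eigenvalues of $H_k$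 of infinite multiplicity. Let $\vartheta(t,\lambda),\varphi(t,\lambda)$ be the solutions of $-y''+qy=\lambda y$ on $[0,1]$ with $\vartheta(0)=\varphi'(0)=1$, $\vartheta'(0)=\varphi(0)=0$; write $\vartheta_t=\vartheta(t,\lambda)$, $\vartheta'_t=\vartheta'(t,\lambda)$, and similarly for $\varphi$. Put $\Delta=\frac12(\varphi'_1+\vartheta_1)$, $F=2\Delta^2+\frac14\varphi_1\vartheta_1'-1$. Let $\sigma_D$ be the spectrum of the Dirichlet problem $-y''+qy=\lambda y$, $y(0)=y(1)=0$, and $\sigma_{AP}=\{\lambda\in\mathbb R:F(\lambda)=-1\}$. **Theorem.** Suppose $c_k=\cos(a+\frac{\pi k}{N})=0$. Then $$\sigma(H_k(a))=\sigma_\infty(H_k(a))=\sigma_D\cup\sigma_{AP}.$$ Moreover let $\lambda\in\sigma_{AP}$. Then $\varphi_1$ and the numbers $$C_1=\varphi_1'+2\Delta,\qquad C_2=-\vartheta_1'-\frac{2\vartheta_1\Delta}{\varphi_1}$$ are nonzero. Define $\psi^{(0)}$ by $$\psi^{(0)}_{0,0}(t)=\vartheta_tC_1+\varphi_tC_2,\quad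 \psi^{(0)}_{0,1}(t)=\vartheta_t-\varphi_t\frac{\vartheta_1}{\varphi_1},\quad \psi^{(0)}_{0,2}(t)=-\frac{\varphi_t}{\varphi_1}e^{ia},$$ $$\psi^{(0)}_{-1,0}=0,\quad \psi^{(0)}_{-1,1}(t)=\frac{\varphi_t}{\varphi_1}e^{-ia}C_1,\quad \psi^{(0)}_{-1,2}(t)=\Big(\vartheta_t-\varphi_t\frac{\vartheta_1}{\varphi_1}\Big)C_1,$$ and $\psi^{(0)}_{n,j}=0$ for all $n\ne-1,0$ and $j=0,1,2$; and let $\psi^{(n)}=(\psi^{(0)}_{m-n,j})_{(m,j)}$. Then $\psi^{(n)}\in\mathcal H_k(\lambda)$ for every $n\in\mathbb Z$, and every $f\in\mathcal H_k(\lambda)$ has the form $$f=\sum_{n\in\mathbb Z}\widehat f_n\psi^{(n)}\ \text{ (unconditionally in } L^2(\Gamma)),\qquad \widehat f_n=f_{n,1}(0)=\frac{f_{n,0}(0)}{C_1}=\frac{f_{n,0}'(0)}{C_2},\qquad (\widehat f_n)\in\ell^2(\mathbb Z),$$ and the mapping $f\mapsto(\widehat f_n)_{n\in\mathbb Z}$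 is a linear isomorphism, bounded together with its inverse, of $\mathcal H_k(\lambda)$ onto $\ell^2(\mathbb Z)$. -/

import Mathlib

open MeasureTheory Set
open scoped ENNReal

noncomputable section

namespace ZigzagTube

/-- Lebesgue measure on the unit interval, i.e. the length measure of one edge. -/
abbrev edgeMeasure : Measure ℝ := volume.restrict (Icc (0 : ℝ) 1)

/-- The complex space `L²(0,1)` of one edge. -/
abbrev EdgeL2 : Type := Lp ℂ 2 edgeMeasure

/-- Real potentials `q ∈ L²(0,1)`. -/
abbrev Potential : Type := Lp ℝ 2 edgeMeasure

/-- `L²(Γ⁽¹⁾)`: the Hilbert sum of the spaces `L²(0,1)` over the edges `Γ_{n,j}` with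
`(n,j) ∈ ℤ × {0,1,2}`. -/
abbrev GraphL2 : Type := lp (fun _ : ℤ × Fin 3 => EdgeL2) 2

/-- `u` is `C¹` on `[0,1]` with derivative `u'` (one-sided at the end points), and `u'` is
absolutely continuous on `[0,1]` with almost everywhere derivative the integrable function `w`. -/
structure HasSecondDeriv (u u' w : ℝ → ℂ) : Prop where
  hasDeriv : ∀ t ∈ Icc (0 : ℝ) 1, HasDerivWithinAt u (u' t) (Icc 0 1) t
  integrable : IntegrableOn w (Icc 0 1)
  deriv_eq : ∀ t ∈ Icc (0 : ℝ) 1, u' t = u' 0 + ∫ x in (0 : ℝ)..t, w x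

/-- `y` (with derivative `y'`) solves `-y'' + q y = lam y` on `[0,1]`. -/
def IsSolution (q : Potential) (lam : ℂ) (y y' : ℝ → ℂ) : Prop :=
  HasSecondDeriv y y' (fun t => ((q t : ℂ) - lam) * y t)

/-- The `L²` function `f` on the graph lies edgewise in the Sobolev space `W^{2,2}(0,1)`, and its
edgewise second derivative `w` is again in `L²` of the graph.  The continuously differentiable
representatives of the edge functions are `u`, and their derivatives are `u'`. -/
def IsRep (f w : GraphL2) (u u' : ℤ → Fin 3 → ℝ → ℂ) : Prop :=
  ∀ n j, (∀ᵐ t ∂edgeMeasure, f (n, j) t = u n j t) ∧ HasSecondDeriv (u n j) (u' n j) (w (n, j))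

/-- The factor `e^{ia}`. -/
def phase (a : ℝ) : ℂ := Complex.exp (Complex.I * a)

/-- The factor `s^k` with `s = e^{2πi/N}`. -/
def sPow (N : ℕ) (k : ℤ) : ℂ := Complex.exp (Complex.I * (2 * Real.pi / N : ℝ)) ^ k

/-- The vertex conditions of `H_k(a)` for the edge functions `u` with derivatives `u'`. -/
structure Kirchhoff (N : ℕ) (k : ℤ) (a : ℝ) (u u' : ℤ → Fin 3 → ℝ → ℂ) : Prop where
  cont_one : ∀ n, u n 0 1 = u n 1 0
  cont_two : ∀ n, u n 1 0 = phase a * sPow N k * u n 2 1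
  cont_three : ∀ n, u (n + 1) 0 0 = phase a * u n 1 1
  cont_four : ∀ n, phase a * u n 1 1 = u n 2 0
  flux_one : ∀ n, -u' n 0 1 + u' n 1 0 - phase a * sPow N k * u' n 2 1 = 0
  flux_two : ∀ n, u' (n + 1) 0 0 - phase a * u' n 1 1 + u' n 2 0 = 0

/-! ### Elementary facts needed to see that the operator is well defined -/

theorem HasSecondDeriv.add {u u' w v v' z : ℝ → ℂ} (h : HasSecondDeriv u u' w)
    (h2 : HasSecondDeriv v v' z) :
    HasSecondDeriv (fun t => u t + v t) (fun t => u' t + v' t) (fun t => w t + z t) := by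
  refine ⟨fun t ht => (h.hasDeriv t ht).add (h2.hasDeriv t ht), h.integrable.add h2.integrable,
    fun t ht => ?_⟩
  have hs : uIoc 0 t ⊆ Icc (0 : ℝ) 1 := by
    rw [uIoc_of_le ht.1]; exact fun x hx => ⟨hx.1.le, hx.2.trans ht.2⟩
  have i1 : IntervalIntegrable w volume 0 t :=
    intervalIntegrable_iff.2 (h.integrable.mono_set hs)
  have i2 : IntervalIntegrable z volume 0 t :=
    intervalIntegrable_iff.2 (h2.integrable.mono_set hs)
  rw [intervalIntegral.integral_add i1 i2, h.deriv_eq t ht, h2.deriv_eq t ht]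
  ring

theorem HasSecondDeriv.const_mul {u u' w : ℝ → ℂ} (c : ℂ) (h : HasSecondDeriv u u' w) :
    HasSecondDeriv (fun t => c * u t) (fun t => c * u' t) (fun t => c * w t) := by
  refine ⟨fun t ht => (h.hasDeriv t ht).const_mul c, h.integrable.const_mul c, fun t ht => ?_⟩
  rw [intervalIntegral.integral_const_mul, h.deriv_eq t ht]
  ring

theorem HasSecondDeriv.congr_ae {u u' w z : ℝ → ℂ} (h : HasSecondDeriv u u' w)
    (hz : ∀ᵐ t ∂edgeMeasure, w t = z t) : HasSecondDeriv u u' z := by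
  refine ⟨h.hasDeriv, h.integrable.congr hz, fun t ht => ?_⟩
  rw [h.deriv_eq t ht]
  congr 1
  refine intervalIntegral.integral_congr_ae ?_
  have := (ae_restrict_iff' measurableSet_Icc).1 hz
  filter_upwards [this] with x hx hx2
  rw [uIoc_of_le ht.1] at hx2
  exact hx ⟨hx2.1.le, hx2.2.trans ht.2⟩

theorem HasSecondDeriv.continuousOn {u u' w : ℝ → ℂ} (h : HasSecondDeriv u u' w) :
    ContinuousOn u (Icc 0 1) := fun t ht => (h.hasDeriv t ht).continuousWithinAt

/-- The second derivative is determined almost everywhere by the function. -/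
theorem HasSecondDeriv.ae_unique {u u' w v v' z : ℝ → ℂ} (h : HasSecondDeriv u u' w)
    (h2 : HasSecondDeriv v v' z) (huv : ∀ᵐ t ∂edgeMeasure, u t = v t) :
    ∀ᵐ t ∂edgeMeasure, w t = z t := by
  have e1 : EqOn u v (Icc 0 1) :=
    Measure.eqOn_Icc_of_ae_eq volume zero_ne_one huv h.continuousOn h2.continuousOn
  have e2 : EqOn u' v' (Icc 0 1) := fun t ht =>
    ((uniqueDiffOn_Icc zero_lt_one t ht).eq_deriv _ (h.hasDeriv t ht)
      ((h2.hasDeriv t ht).congr e1 (e1 ht)))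
  have i1 : IntervalIntegrable w volume 0 1 :=
    (intervalIntegrable_iff_integrableOn_Icc_of_le zero_le_one).2 h.integrable
  have i2 : IntervalIntegrable z volume 0 1 :=
    (intervalIntegrable_iff_integrableOn_Icc_of_le zero_le_one).2 h2.integrable
  have e3 : ∀ t ∈ Icc (0 : ℝ) 1, ∫ x in (0 : ℝ)..t, w x = ∫ x in (0 : ℝ)..t, z x := by
    intro t ht
    have a1 := h.deriv_eq t ht
    have a2 := h2.deriv_eq t ht
    rw [e2 ht, e2 ⟨le_rfl, zero_le_one⟩, a2] at a1
    exact (add_left_cancel a1).symm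
  have hne : ∀ᵐ t : ℝ, t ≠ 0 ∧ t ≠ 1 := by
    filter_upwards [compl_mem_ae_iff.2 (measure_singleton (μ := volume) (0 : ℝ)),
      compl_mem_ae_iff.2 (measure_singleton (μ := volume) (1 : ℝ))] with t h1 h2 using ⟨h1, h2⟩
  rw [ae_restrict_iff' measurableSet_Icc]
  filter_upwards [i1.ae_hasDerivAt_integral, i2.ae_hasDerivAt_integral, hne] with t d1 d2 hn ht
  have hu : t ∈ uIcc (0 : ℝ) 1 := by rwa [uIcc_of_le zero_le_one]
  have b1 := d1 hu 0 left_mem_uIcc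
  have b2 := d2 hu 0 left_mem_uIcc
  refine b1.unique (b2.congr_of_eventuallyEq ?_)
  filter_upwards [Icc_mem_nhds (lt_of_le_of_ne ht.1 hn.1.symm) (lt_of_le_of_ne ht.2 hn.2)]
    with x hx using e3 x hx

instance : IsProbabilityMeasure edgeMeasure := ⟨by simp [edgeMeasure]⟩

theorem HasSecondDeriv.norm_le {u u' w : ℝ → ℂ} (h : HasSecondDeriv u u' w) {t : ℝ}
    (ht : t ∈ Icc (0 : ℝ) 1) :
    ‖u t‖ ≤ 11 * ((∫ x, ‖u x‖ ∂edgeMeasure) + ∫ x, ‖w x‖ ∂edgeMeasure) := by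
  set U := ∫ x, ‖u x‖ ∂edgeMeasure with hU
  set W := ∫ x, ‖w x‖ ∂edgeMeasure with hW
  set A := u 0
  set B := u' 0
  have h0 : (0 : ℝ) ∈ Icc (0 : ℝ) 1 := ⟨le_rfl, zero_le_one⟩
  have hW0 : 0 ≤ W := integral_nonneg fun _ => norm_nonneg _
  have hU0 : 0 ≤ U := integral_nonneg fun _ => norm_nonneg _
  have hd : ∀ s ∈ Icc (0 : ℝ) 1, ‖u' s - B‖ ≤ W := by
    intro s hs
    rw [h.deriv_eq s hs, add_sub_cancel_left, intervalIntegral.integral_of_le hs.1]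
    refine (norm_integral_le_integral_norm _).trans ?_
    exact setIntegral_mono_set h.integrable.norm
      (Filter.Eventually.of_forall fun _ => norm_nonneg _)
      (Filter.Eventually.of_forall fun x hx => ⟨hx.1.le, hx.2.trans hs.2⟩)
  have hR : ∀ s ∈ Icc (0 : ℝ) 1, ‖u s - (A + B * s)‖ ≤ W := by
    intro s hs
    have hder : ∀ x ∈ Icc (0 : ℝ) 1,
        HasDerivWithinAt (fun x : ℝ => u x - (A + B * x)) (u' x - B) (Icc 0 1) x := by
      intro x hx
      have h2 : HasDerivAt (fun x : ℝ => A + B * (x : ℂ)) B x := by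
        simpa using ((hasDerivAt_id x).ofReal_comp.const_mul B).const_add A
      exact (h.hasDeriv x hx).sub h2.hasDerivWithinAt
    have := (convex_Icc (0 : ℝ) 1).norm_image_sub_le_of_norm_hasDerivWithin_le hder hd h0 hs
    have e : u 0 - (A + B * ((0 : ℝ) : ℂ)) = 0 := by simp [A]
    rw [e, sub_zero, sub_zero, Real.norm_eq_abs, abs_of_nonneg hs.1] at this
    exact this.trans (mul_le_of_le_one_right hW0 hs.2)
  have hui : IntervalIntegrable (fun x => ‖u x‖) volume 0 1 := by
    apply ContinuousOn.intervalIntegrable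
    rw [uIcc_of_le zero_le_one]
    exact h.continuousOn.norm
  have hUi : ∫ x in (0 : ℝ)..1, ‖u x‖ = U := by
    rw [intervalIntegral.integral_of_le zero_le_one, hU, integral_Icc_eq_integral_Ioc]
  have key : ∀ (c d M : ℝ), (∀ s ∈ Icc (0 : ℝ) 1, |c + d * s| ≤ M) →
      ‖∫ s in (0 : ℝ)..1, ((c + d * s : ℝ) : ℂ) * (A + B * s)‖ ≤ M * (U + W) := by
    intro c d M hM
    have hM0 : 0 ≤ M := (abs_nonneg _).trans (hM 0 h0)
    have : ∀ s ∈ Ioc (0 : ℝ) 1, ‖((c + d * s : ℝ) : ℂ) * (A + B * s)‖ ≤ M * (‖u s‖ + W) := by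
      intro s hs
      have hs' : s ∈ Icc (0 : ℝ) 1 := ⟨hs.1.le, hs.2⟩
      rw [norm_mul, Complex.norm_real, Real.norm_eq_abs]
      refine mul_le_mul (hM s hs') ?_ (norm_nonneg _) hM0
      have e : A + B * s = u s - (u s - (A + B * s)) := by ring
      rw [e]
      exact (norm_sub_le _ _).trans (by linarith [hR s hs'])
    refine (intervalIntegral.norm_integral_le_of_norm_le zero_le_one
      (Filter.Eventually.of_forall this)
      ((hui.add intervalIntegrable_const).const_mul M)).trans ?_
    rw [intervalIntegral.integral_const_mul, intervalIntegral.integral_add hui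
      intervalIntegrable_const, hUi]
    simp
  have comp : ∀ c d : ℝ, ∫ s in (0 : ℝ)..1, ((c + d * s : ℝ) : ℂ) * (A + B * s)
      = (c + d / 2) * A + (c / 2 + d / 3) * B := by
    intro c d
    have hF : ∀ s : ℝ, HasDerivAt (fun s : ℝ => (c * s + d / 2 * s ^ 2 : ℂ) * A
        + (c / 2 * s ^ 2 + d / 3 * s ^ 3) * B) (((c + d * s : ℝ) : ℂ) * (A + B * s)) s := by
      intro s
      have h1 : HasDerivAt (fun s : ℝ => (s : ℂ)) 1 s := (hasDerivAt_id s).ofReal_comp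
      have h2 := (((h1.const_mul (c : ℂ)).add ((h1.pow 2).const_mul (d / 2 : ℂ))).mul_const A).add
        ((((h1.pow 2).const_mul (c / 2 : ℂ)).add ((h1.pow 3).const_mul (d / 3 : ℂ))).mul_const B)
      refine h2.congr_deriv ?_
      push_cast
      ring
    rw [intervalIntegral.integral_eq_sub_of_hasDerivAt (fun s _ => hF s)
      (by apply Continuous.intervalIntegrable; fun_prop)]
    simp
  have hA : ‖A‖ ≤ 4 * (U + W) := by
    have := key 4 (-6) 4 (fun s hs => by rw [abs_le]; constructor <;> linarith [hs.1, hs.2])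
    rw [comp] at this
    convert this using 2
    push_cast; ring
  have hB : ‖B‖ ≤ 6 * (U + W) := by
    have := key (-6) 12 6 (fun s hs => by rw [abs_le]; constructor <;> linarith [hs.1, hs.2])
    rw [comp] at this
    convert this using 2
    push_cast; ring
  have e : u t = (u t - (A + B * t)) + (A + B * t) := by ring
  have hBt : ‖B * t‖ ≤ ‖B‖ := by
    rw [norm_mul, Complex.norm_real, Real.norm_eq_abs, abs_of_nonneg ht.1]
    exact mul_le_of_le_one_right (norm_nonneg _) ht.2
  have := norm_add_le (u t - (A + B * t)) (A + B * t)
  have h3 := norm_add_le A (B * t)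
  have h4 := hR t ht
  rw [← e] at this
  linarith

theorem integral_norm_le (f : EdgeL2) : ∫ x, ‖f x‖ ∂edgeMeasure ≤ ‖f‖ := by
  have h1 := eLpNorm_le_eLpNorm_of_exponent_le (μ := edgeMeasure) (p := 1) (q := 2)
    (by norm_num) (Lp.aestronglyMeasurable f)
  have h2 := ENNReal.toReal_mono (Lp.memLp f).2.ne h1
  rw [integral_norm_eq_lintegral_enorm (Lp.aestronglyMeasurable f), ← eLpNorm_one_eq_lintegral_enorm]
  exact h2

/-- On one edge, `-w + q f` is in `L²` with the corresponding bound. -/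
theorem exists_edge_value (q : Potential) (f w : EdgeL2) {u u' : ℝ → ℂ}
    (hf : ∀ᵐ t ∂edgeMeasure, f t = u t) (h : HasSecondDeriv u u' w) :
    ∃ g : EdgeL2, (∀ᵐ t ∂edgeMeasure, g t = -w t + (q t : ℂ) * f t) ∧
      ‖g‖ ≤ ‖w‖ + 11 * (‖f‖ + ‖w‖) * ‖q‖ := by
  have hb : ∀ᵐ t ∂edgeMeasure, ‖(q t : ℂ) * f t‖ ≤ (11 * (‖f‖ + ‖w‖)) * ‖q t‖ := by
    filter_upwards [hf, ae_restrict_mem measurableSet_Icc] with t h1 h2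
    rw [norm_mul, Complex.norm_real, h1, mul_comm]
    refine mul_le_mul_of_nonneg_right ((h.norm_le h2).trans ?_) (norm_nonneg _)
    have e : ∫ x, ‖u x‖ ∂edgeMeasure = ∫ x, ‖f x‖ ∂edgeMeasure :=
      integral_congr_ae (by filter_upwards [hf] with x hx; rw [hx])
    rw [e]
    linarith [integral_norm_le f, integral_norm_le w]
  have hm : AEStronglyMeasurable (fun t => (q t : ℂ) * f t) edgeMeasure :=
    (Complex.continuous_ofReal.comp_aestronglyMeasurable (Lp.aestronglyMeasurable q)).mul
      (Lp.aestronglyMeasurable f)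
  have hq : MemLp (fun t => (q t : ℂ) * f t) 2 edgeMeasure :=
    (Lp.memLp q).of_le_mul hm hb
  refine ⟨-w + hq.toLp _, ?_, ?_⟩
  · filter_upwards [Lp.coeFn_add (-w) (hq.toLp _), Lp.coeFn_neg w, hq.coeFn_toLp]
      with t h1 h2 h3
    rw [h1, Pi.add_apply, h2, Pi.neg_apply, h3]
  · refine (norm_add_le _ _).trans ?_
    rw [norm_neg]
    gcongr
    refine Lp.norm_le_mul_norm_of_ae_le_mul ?_
    filter_upwards [hb, hq.coeFn_toLp] with t h1 h2
    rw [h2]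
    exact h1

/-- `f` lies in the domain of `H_k(a)` and `H_k(a) f = g`: the function `f` is in
`W^{2,2}` of the graph, satisfies the vertex conditions, and `g = -f'' + q f` on every edge. -/
def IsValue (q : Potential) (N : ℕ) (k : ℤ) (a : ℝ) (f g : GraphL2) : Prop :=
  ∃ (w : GraphL2) (u u' : ℤ → Fin 3 → ℝ → ℂ), IsRep f w u u' ∧ Kirchhoff N k a u u' ∧
    ∀ n j, ∀ᵐ t ∂edgeMeasure, g (n, j) t = -w (n, j) t + (q t : ℂ) * f (n, j) t

theorem IsRep.add {f w f2 w2 : GraphL2} {u u' v v' : ℤ → Fin 3 → ℝ → ℂ} (h : IsRep f w u u')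
    (h2 : IsRep f2 w2 v v') :
    IsRep (f + f2) (w + w2) (fun n j t => u n j t + v n j t)
      (fun n j t => u' n j t + v' n j t) := by
  intro n j
  refine ⟨?_, ((h n j).2.add (h2 n j).2).congr_ae ?_⟩
  · filter_upwards [(h n j).1, (h2 n j).1, Lp.coeFn_add (f (n, j)) (f2 (n, j))] with t h1 h2 h3
    rw [lp.coeFn_add, Pi.add_apply, h3, Pi.add_apply, h1, h2]
  · filter_upwards [Lp.coeFn_add (w (n, j)) (w2 (n, j))] with t h3
    rw [lp.coeFn_add, Pi.add_apply, h3, Pi.add_apply]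

theorem IsRep.smul {f w : GraphL2} {u u' : ℤ → Fin 3 → ℝ → ℂ} (c : ℂ) (h : IsRep f w u u') :
    IsRep (c • f) (c • w) (fun n j t => c * u n j t) (fun n j t => c * u' n j t) := by
  intro n j
  refine ⟨?_, ((h n j).2.const_mul c).congr_ae ?_⟩
  · filter_upwards [(h n j).1, Lp.coeFn_smul c (f (n, j))] with t h1 h3
    rw [lp.coeFn_smul, Pi.smul_apply, h3, Pi.smul_apply, h1, smul_eq_mul]
  · filter_upwards [Lp.coeFn_smul c (w (n, j))] with t h3
    rw [lp.coeFn_smul, Pi.smul_apply, h3, Pi.smul_apply, smul_eq_mul]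

theorem Kirchhoff.add {N : ℕ} {k : ℤ} {a : ℝ} {u u' v v' : ℤ → Fin 3 → ℝ → ℂ}
    (h : Kirchhoff N k a u u') (h2 : Kirchhoff N k a v v') :
    Kirchhoff N k a (fun n j t => u n j t + v n j t) (fun n j t => u' n j t + v' n j t) where
  cont_one n := by linear_combination h.cont_one n + h2.cont_one n
  cont_two n := by linear_combination h.cont_two n + h2.cont_two n
  cont_three n := by linear_combination h.cont_three n + h2.cont_three n
  cont_four n := by linear_combination h.cont_four n + h2.cont_four n
  flux_one n := by linear_combination h.flux_one n + h2.flux_one n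
  flux_two n := by linear_combination h.flux_two n + h2.flux_two n

theorem Kirchhoff.smul {N : ℕ} {k : ℤ} {a : ℝ} {u u' : ℤ → Fin 3 → ℝ → ℂ} (c : ℂ)
    (h : Kirchhoff N k a u u') :
    Kirchhoff N k a (fun n j t => c * u n j t) (fun n j t => c * u' n j t) where
  cont_one n := by linear_combination c * h.cont_one n
  cont_two n := by linear_combination c * h.cont_two n
  cont_three n := by linear_combination c * h.cont_three n
  cont_four n := by linear_combination c * h.cont_four n
  flux_one n := by linear_combination c * h.flux_one n
  flux_two n := by linear_combination c * h.flux_two n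

theorem hasSecondDeriv_zero : HasSecondDeriv (fun _ => 0) (fun _ => 0) (fun _ => 0) :=
  ⟨fun _ _ => hasDerivWithinAt_const _ _ _, integrable_zero _ _ _, fun _ _ => by simp⟩

/-- The domain `W²(Γ⁽¹⁾)` of `H_k(a)`: all `f ∈ L²` with `f'' ∈ L²` that satisfy the vertex
conditions. -/
def tubeDomain (N : ℕ) (k : ℤ) (a : ℝ) : Submodule ℂ GraphL2 where
  carrier := {f | ∃ (w : GraphL2) (u u' : ℤ → Fin 3 → ℝ → ℂ),
    IsRep f w u u' ∧ Kirchhoff N k a u u'}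
  add_mem' := by
    rintro f f2 ⟨w, u, u', h, hk⟩ ⟨w2, v, v', h2, hk2⟩
    exact ⟨w + w2, _, _, h.add h2, hk.add hk2⟩
  zero_mem' := by
    refine ⟨0, fun _ _ _ => 0, fun _ _ _ => 0, fun n j => ⟨?_, hasSecondDeriv_zero.congr_ae ?_⟩,
      ⟨?_, ?_, ?_, ?_, ?_, ?_⟩⟩
    · exact Lp.coeFn_zero ℂ 2 edgeMeasure
    · filter_upwards [Lp.coeFn_zero ℂ 2 edgeMeasure] with t ht
      exact ht.symm
    all_goals simp
  smul_mem' := by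
    rintro c f ⟨w, u, u', h, hk⟩
    exact ⟨c • w, _, _, h.smul c, hk.smul c⟩

theorem IsValue.unique {q : Potential} {N : ℕ} {k : ℤ} {a : ℝ} {f g g2 : GraphL2}
    (h : IsValue q N k a f g) (h2 : IsValue q N k a f g2) : g = g2 := by
  obtain ⟨w, u, u', hr, -, hg⟩ := h
  obtain ⟨z, v, v', hr2, -, hg2⟩ := h2
  ext ⟨n, j⟩ : 2
  refine Lp.ext ?_
  have huv : ∀ᵐ t ∂edgeMeasure, u n j t = v n j t := by
    filter_upwards [(hr n j).1, (hr2 n j).1] with t h1 h2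
    rw [← h1, h2]
  filter_upwards [hg n j, hg2 n j, (hr n j).2.ae_unique (hr2 n j).2 huv] with t h1 h2 h3
  rw [h1, h2, h3]

theorem exists_value (q : Potential) {N : ℕ} {k : ℤ} {a : ℝ} {f : GraphL2}
    (h : f ∈ tubeDomain N k a) : ∃ g, IsValue q N k a f g := by
  obtain ⟨w, u, u', hr, hk⟩ := h
  choose g hg hb using fun α : ℤ × Fin 3 =>
    exists_edge_value q (f α) (w α) (hr α.1 α.2).1 (hr α.1 α.2).2
  have hmem : Memℓp g 2 := by
    have h1 := (lp.memℓp f).summable (by norm_num)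
    have h2 := (lp.memℓp w).summable (by norm_num)
    refine memℓp_gen ?_
    simp only [ENNReal.toReal_ofNat, Real.rpow_ofNat] at h1 h2 ⊢
    refine Summable.of_nonneg_of_le (fun _ => by positivity) (fun α => ?_)
      ((h1.add h2).mul_left (2 * (1 + 11 * ‖q‖) ^ 2))
    have h0 : ‖g α‖ ≤ (1 + 11 * ‖q‖) * (‖f α‖ + ‖w α‖) := by
      refine (hb α).trans ?_
      nlinarith [norm_nonneg (f α), norm_nonneg (w α), norm_nonneg q]
    calc ‖g α‖ ^ 2 ≤ ((1 + 11 * ‖q‖) * (‖f α‖ + ‖w α‖)) ^ 2 := by gcongr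
      _ ≤ _ := by
        rw [mul_pow, mul_assoc, mul_comm 2, mul_assoc]
        have := add_sq_le (a := ‖f α‖) (b := ‖w α‖)
        gcongr
        linarith
  exact ⟨⟨g, hmem⟩, w, u, u', hr, hk, fun n j => hg (n, j)⟩

theorem IsValue.add {q : Potential} {N : ℕ} {k : ℤ} {a : ℝ} {f g f2 g2 : GraphL2}
    (h : IsValue q N k a f g) (h2 : IsValue q N k a f2 g2) :
    IsValue q N k a (f + f2) (g + g2) := by
  obtain ⟨w, u, u', hr, hk, hg⟩ := h
  obtain ⟨z, v, v', hr2, hk2, hg2⟩ := h2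
  refine ⟨w + z, _, _, hr.add hr2, hk.add hk2, fun n j => ?_⟩
  filter_upwards [hg n j, hg2 n j, Lp.coeFn_add (f (n, j)) (f2 (n, j)),
    Lp.coeFn_add (g (n, j)) (g2 (n, j)), Lp.coeFn_add (w (n, j)) (z (n, j))] with t h1 h2 h3 h4 h5
  rw [lp.coeFn_add, lp.coeFn_add, lp.coeFn_add, Pi.add_apply, Pi.add_apply, Pi.add_apply, h3, h4,
    h5, Pi.add_apply, Pi.add_apply, Pi.add_apply, h1, h2]
  ring

theorem IsValue.smul {q : Potential} {N : ℕ} {k : ℤ} {a : ℝ} {f g : GraphL2} (c : ℂ)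
    (h : IsValue q N k a f g) : IsValue q N k a (c • f) (c • g) := by
  obtain ⟨w, u, u', hr, hk, hg⟩ := h
  refine ⟨c • w, _, _, hr.smul c, hk.smul c, fun n j => ?_⟩
  filter_upwards [hg n j, Lp.coeFn_smul c (f (n, j)), Lp.coeFn_smul c (g (n, j)),
    Lp.coeFn_smul c (w (n, j))] with t h1 h3 h4 h5
  rw [lp.coeFn_smul, lp.coeFn_smul, lp.coeFn_smul, Pi.smul_apply, Pi.smul_apply, Pi.smul_apply,
    h3, h4, h5, Pi.smul_apply, Pi.smul_apply, Pi.smul_apply, h1]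
  simp only [smul_eq_mul]
  ring

/-- The operator `H_k(a)` in `L²(Γ⁽¹⁾)` with domain `W²(Γ⁽¹⁾)`; it acts as `-f'' + q f` on each
edge. -/
def tubeOperator (q : Potential) (N : ℕ) (k : ℤ) (a : ℝ) : GraphL2 →ₗ.[ℂ] GraphL2 where
  domain := tubeDomain N k a
  toFun :=
    { toFun := fun f => Classical.choose (exists_value q f.2)
      map_add' := fun f f2 => (Classical.choose_spec (exists_value q (f + f2).2)).unique
        ((Classical.choose_spec (exists_value q f.2)).add
          (Classical.choose_spec (exists_value q f2.2)))
      map_smul' := fun c f => (Classical.choose_spec (exists_value q (c • f).2)).unique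
        ((Classical.choose_spec (exists_value q f.2)).smul c) }

theorem tubeOperator_spec (q : Potential) (N : ℕ) (k : ℤ) (a : ℝ)
    (f : (tubeOperator q N k a).domain) : IsValue q N k a f (tubeOperator q N k a f) :=
  Classical.choose_spec (exists_value q f.2)

/-- Every initial value problem for `-y'' + q y = lam y` on `[0,1]` has a solution. -/
theorem exists_solution (q : Potential) (lam A B : ℂ) :
    ∃ y : (ℝ → ℂ) × (ℝ → ℂ), IsSolution q lam y.1 y.2 ∧ y.1 0 = A ∧ y.2 0 = B := by
  have hp2 : MemLp (fun t => (q t : ℂ) - lam) 2 edgeMeasure :=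
    (MemLp.ofReal (Lp.memLp q)).sub (memLp_const lam)
  have hsq : IntegrableOn (fun t => ‖(q t : ℂ) - lam‖ ^ 2) (Icc 0 1) :=
    hp2.integrable_norm_pow (by norm_num)
  have hp1 : IntegrableOn (fun t => (q t : ℂ) - lam) (Icc 0 1) := hp2.integrable (by norm_num)
  set P : ℝ → ℂ := (Icc (0 : ℝ) 1).indicator (fun t => (q t : ℂ) - lam) with hP
  have hPi : Integrable P := (integrable_indicator_iff measurableSet_Icc).2 hp1
  have hPsq : Integrable (fun t => ‖P t‖ ^ 2) := by
    have := (integrable_indicator_iff measurableSet_Icc).2 hsq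
    refine this.congr (Filter.Eventually.of_forall fun t => ?_)
    by_cases ht : t ∈ Icc (0 : ℝ) 1 <;> simp [hP, indicator, ht]
  set K := ∫ t, ‖P t‖ ^ 2 with hK
  have hK0 : 0 ≤ K := integral_nonneg fun _ => by positivity
  set c : ℝ := K + 1 with hc
  have hc0 : 0 < c := by positivity
  let X := C(Icc (0 : ℝ) 1, ℂ)
  let ex : X → ℝ → ℂ := fun z x => (Real.exp (c * x) : ℂ) * z (projIcc 0 1 zero_le_one x)
  have hex : ∀ z : X, Continuous (ex z) := by
    intro z
    have : Continuous fun x => z (projIcc (0 : ℝ) 1 zero_le_one x) :=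
      z.continuous.comp continuous_projIcc
    exact (by fun_prop : Continuous fun x : ℝ => (Real.exp (c * x) : ℂ)).mul this
  have hint : ∀ (z : X) (s t : ℝ), IntervalIntegrable (fun x => P x * ex z x) volume s t :=
    fun z s t => hPi.intervalIntegrable.mul_continuousOn (hex z).continuousOn
  let G : X → ℝ → ℂ := fun z s => ∫ x in (0 : ℝ)..s, P x * ex z x
  have hG : ∀ z, Continuous (G z) := fun z => intervalIntegral.continuous_primitive (hint z) 0
  let Y : X → ℝ → ℂ := fun z t => A + ∫ s in (0 : ℝ)..t, (B + G z s)
  have hYd : ∀ z t, HasDerivAt (Y z) (B + G z t) t := fun z t =>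
    ((continuous_const.add (hG z)).integral_hasStrictDerivAt 0 t).hasDerivAt.const_add A
  have hY : ∀ z, Continuous (Y z) := fun z =>
    continuous_iff_continuousAt.2 fun t => (hYd z t).continuousAt
  let T : X → X := fun z =>
    ⟨fun t => (Real.exp (-(c * t)) : ℂ) * Y z t, by
      have := hY z
      fun_prop⟩
  have kern : ∀ s : ℝ, 0 ≤ s → ∫ x in (0 : ℝ)..s, ‖P x‖ * Real.exp (c * x) ≤
      3 / 4 * Real.exp (c * s) := by
    intro s hs
    have pw : ∀ x : ℝ, ‖P x‖ * Real.exp (c * x) ≤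
        Real.exp (c * s) * (1 / (2 * c) * ‖P x‖ ^ 2) +
          c / 2 * (Real.exp (-(c * s)) * Real.exp (2 * c * x)) := by
      intro x
      have e1 : Real.exp (2 * c * x) = Real.exp (c * x) ^ 2 := by
        rw [← Real.exp_nat_mul]; congr 1; push_cast; ring
      have e2 : Real.exp (-(c * s)) = (Real.exp (c * s))⁻¹ := Real.exp_neg _
      rw [e1, e2]
      set E := Real.exp (c * s)
      set F := Real.exp (c * x)
      have hE : 0 < E := Real.exp_pos _
      have : E * (1 / (2 * c) * ‖P x‖ ^ 2) + c / 2 * (E⁻¹ * F ^ 2) - ‖P x‖ * F =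
          (E * ‖P x‖ - c * F) ^ 2 / (2 * c * E) := by
        field_simp
        ring
      have h2 : 0 ≤ (E * ‖P x‖ - c * F) ^ 2 / (2 * c * E) := by positivity
      linarith
    have i1 : IntervalIntegrable (fun x => Real.exp (c * s) * (1 / (2 * c) * ‖P x‖ ^ 2))
        volume 0 s := ((hPsq.const_mul _).const_mul _).intervalIntegrable
    have i2 : IntervalIntegrable
        (fun x => c / 2 * (Real.exp (-(c * s)) * Real.exp (2 * c * x))) volume 0 s :=
      Continuous.intervalIntegrable (by fun_prop) _ _
    have i0 : IntervalIntegrable (fun x => ‖P x‖ * Real.exp (c * x)) volume 0 s :=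
      hPi.norm.intervalIntegrable.mul_continuousOn
        (by fun_prop : Continuous fun x : ℝ => Real.exp (c * x)).continuousOn
    refine (intervalIntegral.integral_mono_on hs i0 (i1.add i2) fun x _ => pw x).trans ?_
    rw [intervalIntegral.integral_add i1 i2]
    simp only [intervalIntegral.integral_const_mul]
    have b1 : ∫ x in (0 : ℝ)..s, ‖P x‖ ^ 2 ≤ K := by
      rw [intervalIntegral.integral_of_le hs]
      exact setIntegral_le_integral hPsq (Filter.Eventually.of_forall fun _ => by positivity)
    have b2 : ∫ x in (0 : ℝ)..s, Real.exp (2 * c * x) =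
        (Real.exp (2 * c * s) - 1) / (2 * c) := by
      have hd : ∀ x : ℝ, HasDerivAt (fun x => Real.exp (2 * c * x) / (2 * c))
          (Real.exp (2 * c * x)) x := by
        intro x
        refine ((((hasDerivAt_id x).const_mul (2 * c)).exp).div_const (2 * c)).congr_deriv ?_
        simp only [id, mul_one]
        field_simp
      rw [intervalIntegral.integral_eq_sub_of_hasDerivAt (fun x _ => hd x)
        (Continuous.intervalIntegrable (by fun_prop) _ _)]
      simp only [mul_zero, Real.exp_zero]
      ring
    rw [b2]
    have e1 : Real.exp (2 * c * s) = Real.exp (c * s) ^ 2 := by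
      rw [← Real.exp_nat_mul]; congr 1; push_cast; ring
    rw [e1, Real.exp_neg]
    set E := Real.exp (c * s)
    have hE : 0 < E := Real.exp_pos _
    have t2 : c / 2 * (E⁻¹ * ((E ^ 2 - 1) / (2 * c))) ≤ E / 4 := by
      have : E / 4 - c / 2 * (E⁻¹ * ((E ^ 2 - 1) / (2 * c))) = E⁻¹ / 4 := by
        field_simp
        ring
      have h3 : 0 ≤ E⁻¹ / 4 := by positivity
      linarith
    have t1 : 1 / (2 * c) * ∫ x in (0 : ℝ)..s, ‖P x‖ ^ 2 ≤ 1 / 2 := by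
      rw [div_mul_eq_mul_div, one_mul, div_le_iff₀ (by positivity)]
      linarith
    have := mul_le_mul_of_nonneg_left t1 hE.le
    linarith
  have hT : ContractingWith (3 / 4) T := by
    refine ⟨by rw [← NNReal.coe_lt_coe]; norm_num, LipschitzWith.of_dist_le_mul fun z v => ?_⟩
    rw [ContinuousMap.dist_le (by positivity)]
    intro t
    have hdist : ∀ x, ‖z x - v x‖ ≤ dist z v := fun x => by
      rw [← dist_eq_norm]; exact ContinuousMap.dist_apply_le_dist x
    have gd : ∀ s : ℝ, 0 ≤ s → ‖G z s - G v s‖ ≤ 3 / 4 * Real.exp (c * s) * dist z v := by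
      intro s hs
      have : G z s - G v s = ∫ x in (0 : ℝ)..s, (P x * ex z x - P x * ex v x) :=
        (intervalIntegral.integral_sub (hint z 0 s) (hint v 0 s)).symm
      rw [this]
      have i0 : IntervalIntegrable (fun x => ‖P x‖ * Real.exp (c * x)) volume 0 s :=
        hPi.norm.intervalIntegrable.mul_continuousOn
          (by fun_prop : Continuous fun x : ℝ => Real.exp (c * x)).continuousOn
      refine (intervalIntegral.norm_integral_le_of_norm_le hs
        (g := fun x => ‖P x‖ * Real.exp (c * x) * dist z v)
        (Filter.Eventually.of_forall fun x _ => ?_) (i0.mul_const _)).trans ?_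
      · have : P x * ex z x - P x * ex v x = P x * (Real.exp (c * x) : ℂ) *
            (z (projIcc 0 1 zero_le_one x) - v (projIcc 0 1 zero_le_one x)) := by
          simp only [ex]; ring
        rw [this, norm_mul, norm_mul, Complex.norm_real, Real.norm_eq_abs, Real.abs_exp]
        exact mul_le_mul_of_nonneg_left (hdist _) (by positivity)
      · rw [intervalIntegral.integral_mul_const]
        exact mul_le_mul_of_nonneg_right (kern s hs) dist_nonneg
    have yd : ‖Y z t - Y v t‖ ≤ 3 / 4 * Real.exp (c * t) * dist z v := by
      have : Y z t - Y v t = ∫ s in (0 : ℝ)..t, ((B + G z s) - (B + G v s)) := by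
        have hs := intervalIntegral.integral_sub (μ := volume) (a := 0) (b := (t : ℝ))
          (f := fun s => B + G z s) (g := fun s => B + G v s)
          ((continuous_const.add (hG z)).intervalIntegrable _ _)
          ((continuous_const.add (hG v)).intervalIntegrable _ _)
        rw [hs]
        simp only [Y]; ring
      rw [this]
      have hb : ∀ s ∈ uIoc (0 : ℝ) t, ‖(B + G z s) - (B + G v s)‖ ≤
          3 / 4 * Real.exp (c * t) * dist z v := by
        intro s hs
        rw [uIoc_of_le t.2.1] at hs
        rw [add_sub_add_left_eq_sub]
        refine (gd s hs.1.le).trans ?_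
        have := hs.2
        gcongr
      refine (intervalIntegral.norm_integral_le_of_norm_le_const hb).trans ?_
      rw [sub_zero, abs_of_nonneg t.2.1]
      exact mul_le_of_le_one_right (by positivity) t.2.2
    have e : T z t - T v t = (Real.exp (-(c * t)) : ℂ) * (Y z t - Y v t) := by
      rw [mul_sub]; rfl
    rw [dist_eq_norm, e, norm_mul, Complex.norm_real, Real.norm_eq_abs, Real.abs_exp]
    refine (mul_le_mul_of_nonneg_left yd (Real.exp_pos _).le).trans (le_of_eq ?_)
    rw [Real.exp_neg]
    have := (Real.exp_pos (c * t)).ne'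
    push_cast
    field_simp
  obtain ⟨z, hz⟩ : ∃ z, T z = z := ⟨_, hT.fixedPoint_isFixedPt⟩
  have hzY : ∀ x ∈ Icc (0 : ℝ) 1, ex z x = Y z x := by
    intro x hx
    have h1 : (Real.exp (-(c * x)) : ℂ) * Y z x = z ⟨x, hx⟩ :=
      congrArg (fun v : X => v ⟨x, hx⟩) hz
    simp only [ex]
    rw [projIcc_of_mem zero_le_one hx, ← h1, ← mul_assoc, ← Complex.ofReal_mul, ← Real.exp_add]
    simp
  refine ⟨(Y z, fun t => B + G z t), ⟨fun t _ => (hYd z t).hasDerivWithinAt, ?_, ?_⟩, ?_, ?_⟩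
  · exact hp1.mul_continuousOn (hY z).continuousOn isCompact_Icc
  · intro t ht
    have h0 : G z 0 = 0 := intervalIntegral.integral_same
    simp only [h0, add_zero]
    congr 1
    refine intervalIntegral.integral_congr fun x hx => ?_
    rw [uIcc_of_le ht.1] at hx
    have hx' : x ∈ Icc (0 : ℝ) 1 := ⟨hx.1, hx.2.trans ht.2⟩
    simp only [hP, indicator_of_mem hx', hzY x hx']
  · simp [Y]
  · simp [G]

/-- The solution of `-y'' + q y = lam y` on `[0,1]` with `y(0) = A`, `y'(0) = B`, together with
its derivative. -/
def cauchySol (q : Potential) (lam A B : ℂ) : (ℝ → ℂ) × (ℝ → ℂ) :=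
  Classical.choose (exists_solution q lam A B)

theorem cauchySol_spec (q : Potential) (lam A B : ℂ) :
    IsSolution q lam (cauchySol q lam A B).1 (cauchySol q lam A B).2 ∧
      (cauchySol q lam A B).1 0 = A ∧ (cauchySol q lam A B).2 0 = B :=
  Classical.choose_spec (exists_solution q lam A B)

/-- The fundamental solution `ϑ(t, lam)`. -/
def theta (q : Potential) (lam : ℂ) (t : ℝ) : ℂ := (cauchySol q lam 1 0).1 t

/-- The derivative `ϑ'(t, lam)` in `t`. -/
def theta' (q : Potential) (lam : ℂ) (t : ℝ) : ℂ := (cauchySol q lam 1 0).2 t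

/-- The fundamental solution `φ(t, lam)`. -/
def phi (q : Potential) (lam : ℂ) (t : ℝ) : ℂ := (cauchySol q lam 0 1).1 t

/-- The derivative `φ'(t, lam)` in `t`. -/
def phi' (q : Potential) (lam : ℂ) (t : ℝ) : ℂ := (cauchySol q lam 0 1).2 t

/-- The Lyapunov function `Δ = (φ'(1,·) + ϑ(1,·)) / 2`. -/
def lyapunov (q : Potential) (lam : ℂ) : ℂ := (phi' q lam 1 + theta q lam 1) / 2

/-- `F = 2 Δ² + φ(1,·) ϑ'(1,·) / 4 - 1`. -/
def bigF (q : Potential) (lam : ℂ) : ℂ :=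
  2 * lyapunov q lam ^ 2 + phi q lam 1 * theta' q lam 1 / 4 - 1

/-- `σ_D`: the Dirichlet spectrum of `-y'' + q y` on `[0,1]`. -/
def dirichletSpectrum (q : Potential) : Set ℂ :=
  {lam | ∃ y y' : ℝ → ℂ, IsSolution q lam y y' ∧ y 0 = 0 ∧ y 1 = 0 ∧ ∃ t ∈ Icc (0 : ℝ) 1, y t ≠ 0}

/-- `σ_AP = {lam ∈ ℝ : F(lam) = -1}`. -/
def singularEnergies (q : Potential) : Set ℝ := {lam | bigF q (lam : ℂ) = -1}

section Spectrum

variable {E : Type*} [NormedAddCommGroup E] [InnerProductSpace ℂ E]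

/-- The spectrum of an unbounded operator `T`: all `lam` for which `T - lam` has no bounded
everywhere defined inverse. -/
def opSpectrum (T : E →ₗ.[ℂ] E) : Set ℂ :=
  {lam | ¬ ∃ R : E →L[ℂ] E,
    (∀ x : E, ∃ h : R x ∈ T.domain, T ⟨R x, h⟩ - lam • R x = x) ∧
    ∀ y : T.domain, R (T y - lam • (y : E)) = y}

/-- The space `{ψ ∈ D(T) : T ψ = lam ψ}`. -/
def opEigenspace (T : E →ₗ.[ℂ] E) (lam : ℂ) : Submodule ℂ E :=
  (LinearMap.ker (T.toFun - lam • T.domain.subtype)).map T.domain.subtype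

/-- `σ_∞(T)`: the eigenvalues of `T` of infinite multiplicity. -/
def infiniteEigenvalues (T : E →ₗ.[ℂ] E) : Set ℂ :=
  {lam | opEigenspace T lam ≠ ⊥ ∧ ¬ FiniteDimensional ℂ (opEigenspace T lam)}

end Spectrum

/-- The constant `C₁ = φ'(1) + 2 Δ`. -/
def constOne (q : Potential) (lam : ℂ) : ℂ := phi' q lam 1 + 2 * lyapunov q lam

/-- The constant `C₂ = -ϑ'(1) - 2 ϑ(1) Δ / φ(1)`. -/
def constTwo (q : Potential) (lam : ℂ) : ℂ :=
  -theta' q lam 1 - 2 * theta q lam 1 * lyapunov q lam / phi q lam 1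

/-- The edge functions `ψ⁽⁰⁾_{n,j}` of the explicit eigenfunction. -/
def psiZero (q : Potential) (a : ℝ) (lam : ℂ) (n : ℤ) (j : Fin 3) (t : ℝ) : ℂ :=
  if n = 0 then
    match j with
    | 0 => theta q lam t * constOne q lam + phi q lam t * constTwo q lam
    | 1 => theta q lam t - phi q lam t * theta q lam 1 / phi q lam 1
    | 2 => -(phi q lam t / phi q lam 1) * phase a
  else if n = -1 then
    match j with
    | 0 => 0
    | 1 => phi q lam t / phi q lam 1 * phase (-a) * constOne q lam
    | 2 => (theta q lam t - phi q lam t * theta q lam 1 / phi q lam 1) * constOne q lam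
  else 0

end ZigzagTube

end

open ZigzagTube

/-! When `c_k = 0`, the factor `e^{ia} s^k` equals `-e^{-ia}` (`phase_mul_sPow`), and the transport
between neighbouring loops cancels. Let `x n` be the value at the start of edge `(n,1)` and `y n`
the value at the start of edge `(n,2)`. Continuity expresses every other end value through these. If
`φ(1) ≠ 0`, a solution on an edge is fixed by its two end values, so the flux conditions become
relations between the numbers `x` and `y`. In the first condition the two contributions of `y n`
cancel, and in the second those of `x n`. What is left is `y (n-1) = C₁ x n` and `x n = C₃ y (n-1)`
with `C₃ = ϑ(1) + 2Δ`: a separate 2×2 system for each `n` (`Kirchhoff.vertex_relations`; converse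
with a source term in `kirchhoff_of_vertex_values`). By the Wronskian identity its determinant is `1
- C₁C₃ = -4(F + 1)` (`constOne_mul_constThree`).

If `φ(1) ≠ 0` and `C₁C₃ ≠ 1`, the homogeneous system has only the zero solution
(`opEigenspace_eq_bot`). The inhomogeneous one is solved cell by cell with uniform bounds
(`exists_bounded_solution`), so `lam` is in the resolvent set.

If `φ(1) ≠ 0` and `C₁C₃ = 1`, the sequence `x` is free and determines the function: `x = δ₀` gives
`ψ⁽⁰⁾`, supported on the cells `-1` and `0`. On the edges `(n,0)` only `ψ⁽ⁿ⁾` is present, which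
bounds the coefficients by the function. Hence synthesis from `ℓ²` is an isomorphism onto the
eigenspace (`eigenspace_expansion`).

If `φ(1) = 0`, an explicit combination of Dirichlet solutions on two neighbouring cells satisfies
the vertex conditions; its translates make the multiplicity infinite (`dirichletSolution`).

The identity `F = -1` is first met at complex `lam`. Green's identity for a compactly supported
eigenfunction shows that such energies are real (`LocalSolution.real`), as the definition of `σ_AP`
requires. -/

noncomputable section

namespace ZigzagTube

/-! ### Calculus of absolutely continuous functions on one edge -/

/-- `A` is on `[0,1]` the primitive of the integrable function `a`. -/
def IsPrimitive (A a : ℝ → ℂ) : Prop :=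
  IntegrableOn a (Icc 0 1) ∧ ∀ t ∈ Icc (0 : ℝ) 1, A t = A 0 + ∫ x in (0 : ℝ)..t, a x

theorem zero_mem_unit : (0 : ℝ) ∈ Icc (0 : ℝ) 1 := ⟨le_rfl, zero_le_one⟩

theorem one_mem_unit : (1 : ℝ) ∈ Icc (0 : ℝ) 1 := ⟨zero_le_one, le_rfl⟩

theorem intervalIntegrable_of_unit {E : Type*} [NormedAddCommGroup E] {w : ℝ → E}
    (h : IntegrableOn w (Icc 0 1)) {t : ℝ} (ht : t ∈ Icc (0 : ℝ) 1) :
    IntervalIntegrable w volume 0 t := by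
  refine intervalIntegrable_iff.2 (h.mono_set ?_)
  rw [uIoc_of_le ht.1]
  exact fun x hx => ⟨hx.1.le, hx.2.trans ht.2⟩

theorem absolutelyContinuous_const {E : Type*} [NormedAddCommGroup E] (c : E) (s t : ℝ) :
    AbsolutelyContinuousOnInterval (fun _ : ℝ => c) s t :=
  (LipschitzWith.const c).lipschitzOnWith.absolutelyContinuousOnInterval

/-- The integral is assembled from its real and imaginary parts, each of which is the primitive of a
real integrable function. -/
theorem absolutelyContinuous_integral {w : ℝ → ℂ} (h : IntegrableOn w (Icc 0 1)) :
    AbsolutelyContinuousOnInterval (fun t => ∫ x in (0 : ℝ)..t, w x) 0 1 := by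
  have hi := intervalIntegrable_of_unit h one_mem_unit
  have hre : IntervalIntegrable (fun x => (w x).re) volume 0 1 :=
    intervalIntegrable_of_unit h.re one_mem_unit
  have him : IntervalIntegrable (fun x => (w x).im) volume 0 1 :=
    intervalIntegrable_of_unit h.im one_mem_unit
  have h1 := (hre.absolutelyContinuousOnInterval_intervalIntegral
    (c := 0) left_mem_uIcc).fun_smul (absolutelyContinuous_const (1 : ℂ) 0 1)
  have h2 := (him.absolutelyContinuousOnInterval_intervalIntegral
    (c := 0) left_mem_uIcc).fun_smul (absolutelyContinuous_const Complex.I 0 1)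
  have h3 := h1.fun_add h2
  -- Absolute continuity is a limit along families of subintervals of `[0,1]`, so it suffices that
  -- the functions agree on `[0,1]`.
  refine (Filter.tendsto_congr' ?_).1 h3
  have key : ∀ t ∈ uIcc (0 : ℝ) 1, ((∫ x in (0 : ℝ)..t, (w x).re) • (1 : ℂ) +
      (∫ x in (0 : ℝ)..t, (w x).im) • Complex.I) = ∫ x in (0 : ℝ)..t, w x := by
    intro t ht
    rw [uIcc_of_le zero_le_one] at ht
    have i1 := intervalIntegrable_of_unit h ht
    have e1 := Complex.reCLM.intervalIntegral_comp_comm i1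
    have e2 := Complex.imCLM.intervalIntegral_comp_comm i1
    simp only [Complex.reCLM_apply, Complex.imCLM_apply] at e1 e2
    rw [e1, e2]
    simp only [Complex.real_smul, mul_one]
    exact Complex.re_add_im _
  filter_upwards [Filter.mem_inf_of_right (Filter.mem_principal_self _)] with E hE
  refine Finset.sum_congr rfl fun i hi => ?_
  have := hE.1 i hi
  rw [key _ this.1, key _ this.2]

theorem IsPrimitive.absolutelyContinuous {A a : ℝ → ℂ} (h : IsPrimitive A a) :
    AbsolutelyContinuousOnInterval A 0 1 := by
  have h1 := (absolutelyContinuous_const (A 0) 0 1).fun_add (absolutelyContinuous_integral h.1)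
  refine (Filter.tendsto_congr' ?_).1 h1
  filter_upwards [Filter.mem_inf_of_right (Filter.mem_principal_self _)] with E hE
  refine Finset.sum_congr rfl fun i hi => ?_
  have := hE.1 i hi
  rw [uIcc_of_le zero_le_one] at this
  rw [h.2 _ this.1, h.2 _ this.2]

theorem IsPrimitive.continuousOn {A a : ℝ → ℂ} (h : IsPrimitive A a) :
    ContinuousOn A (Icc 0 1) := by
  have := h.absolutelyContinuous.continuousOn
  rwa [uIcc_of_le zero_le_one] at this

theorem IsPrimitive.ae_hasDerivAt {A a : ℝ → ℂ} (h : IsPrimitive A a) :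
    ∀ᵐ t : ℝ, t ∈ Icc (0 : ℝ) 1 → HasDerivAt A (a t) t := by
  have hne : ∀ᵐ t : ℝ, t ≠ 0 ∧ t ≠ 1 := by
    filter_upwards [compl_mem_ae_iff.2 (measure_singleton (μ := volume) (0 : ℝ)),
      compl_mem_ae_iff.2 (measure_singleton (μ := volume) (1 : ℝ))] with t h1 h2 using ⟨h1, h2⟩
  filter_upwards [(intervalIntegrable_of_unit h.1 one_mem_unit).ae_hasDerivAt_integral, hne]
    with t d hn ht
  have hu : t ∈ uIcc (0 : ℝ) 1 := by rwa [uIcc_of_le zero_le_one]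
  refine ((d hu 0 left_mem_uIcc).const_add (A 0)).congr_of_eventuallyEq ?_
  filter_upwards [Icc_mem_nhds (lt_of_le_of_ne ht.1 hn.1.symm) (lt_of_le_of_ne ht.2 hn.2)]
    with x hx using h.2 x hx

/-- The difference between `A` and the integral of `a` is absolutely continuous with derivative zero
almost everywhere, hence constant. Since `q` is only in `L²`, second derivatives exist only almost
everywhere; this criterion lets product rules be checked pointwise almost everywhere. -/
theorem IsPrimitive.of_absolutelyContinuous {A a : ℝ → ℂ}
    (hA : AbsolutelyContinuousOnInterval A 0 1) (ha : IntegrableOn a (Icc 0 1))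
    (hd : ∀ᵐ t : ℝ, t ∈ Icc (0 : ℝ) 1 → HasDerivAt A (a t) t) : IsPrimitive A a := by
  refine ⟨ha, ?_⟩
  have hp : IsPrimitive (fun t => ∫ x in (0 : ℝ)..t, a x) a := ⟨ha, fun t _ => by simp⟩
  obtain ⟨C, hC⟩ := (hA.fun_sub hp.absolutelyContinuous).const_of_ae_hasDerivAt_zero (by
    filter_upwards [hd, hp.ae_hasDerivAt] with t h1 h2 ht
    rw [uIcc_of_le zero_le_one] at ht
    simpa using (h1 ht).fun_sub (h2 ht))
  rw [uIcc_of_le zero_le_one] at hC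
  intro t ht
  have h0 := hC 0 zero_mem_unit
  have h1 := hC t ht
  simp only [intervalIntegral.integral_same, sub_zero] at h0
  rw [h0, ← h1]
  ring

theorem IsPrimitive.mul {A a B b : ℝ → ℂ} (hA : IsPrimitive A a) (hB : IsPrimitive B b) :
    IsPrimitive (fun t => A t * B t) (fun t => a t * B t + A t * b t) := by
  refine .of_absolutelyContinuous (hA.absolutelyContinuous.fun_smul hB.absolutelyContinuous)
    ((hA.1.mul_continuousOn hB.continuousOn isCompact_Icc).add
      (hB.1.continuousOn_mul hA.continuousOn isCompact_Icc)) ?_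
  filter_upwards [hA.ae_hasDerivAt, hB.ae_hasDerivAt] with t h1 h2 ht
  exact (h1 ht).mul (h2 ht)

theorem IsPrimitive.sub {A a B b : ℝ → ℂ} (hA : IsPrimitive A a) (hB : IsPrimitive B b) :
    IsPrimitive (fun t => A t - B t) (fun t => a t - b t) := by
  refine .of_absolutelyContinuous (hA.absolutelyContinuous.fun_sub hB.absolutelyContinuous)
    (hA.1.sub hB.1) ?_
  filter_upwards [hA.ae_hasDerivAt, hB.ae_hasDerivAt] with t h1 h2 ht
  exact (h1 ht).sub (h2 ht)

theorem IsPrimitive.congr_deriv {A a b : ℝ → ℂ} (hA : IsPrimitive A a)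
    (h : ∀ t ∈ Icc (0 : ℝ) 1, a t = b t) : IsPrimitive A b := by
  refine ⟨hA.1.congr_fun h measurableSet_Icc, fun t ht => ?_⟩
  rw [hA.2 t ht]
  congr 1
  refine intervalIntegral.integral_congr fun x hx => h x ?_
  rw [uIcc_of_le ht.1] at hx
  exact ⟨hx.1, hx.2.trans ht.2⟩

theorem IsPrimitive.hasDerivWithinAt {A a : ℝ → ℂ} (h : IsPrimitive A a)
    (ha : ContinuousOn a (Icc 0 1)) {t : ℝ} (ht : t ∈ Icc (0 : ℝ) 1) :
    HasDerivWithinAt A (a t) (Icc 0 1) t := by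
  have : Fact (t ∈ Icc (0 : ℝ) 1) := ⟨ht⟩
  have d := intervalIntegral.integral_hasDerivWithinAt_right (intervalIntegrable_of_unit h.1 ht)
    (s := Icc 0 1) (t := Icc 0 1)
    (ha.stronglyMeasurableAtFilter_nhdsWithin measurableSet_Icc t) (ha t ht)
  exact (d.const_add (A 0)).congr (fun x hx => h.2 x hx) (h.2 t ht)

theorem HasSecondDeriv.primitive_deriv {u u' w : ℝ → ℂ} (h : HasSecondDeriv u u' w) :
    IsPrimitive u' w := ⟨h.integrable, h.deriv_eq⟩

theorem HasSecondDeriv.primitive {u u' w : ℝ → ℂ} (h : HasSecondDeriv u u' w) :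
    IsPrimitive u u' := by
  have hc := h.primitive_deriv.continuousOn
  refine ⟨hc.integrableOn_Icc, fun t ht => ?_⟩
  have hs : uIcc 0 t ⊆ Icc (0 : ℝ) 1 := by
    rw [uIcc_of_le ht.1]; exact fun x hx => ⟨hx.1, hx.2.trans ht.2⟩
  rw [intervalIntegral.integral_eq_sub_of_hasDerivAt_of_le ht.1
    (h.continuousOn.mono (by rw [← uIcc_of_le ht.1]; exact hs))
    (fun x hx => (h.hasDeriv x ⟨hx.1.le, hx.2.le.trans ht.2⟩).hasDerivAt
      (Icc_mem_nhds hx.1 (hx.2.trans_le ht.2))) (intervalIntegrable_of_unit hc.integrableOn_Icc ht)]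
  ring

theorem HasSecondDeriv.of_primitive {u u' w : ℝ → ℂ} (h : IsPrimitive u u')
    (h' : IsPrimitive u' w) : HasSecondDeriv u u' w :=
  ⟨fun _ ht => h.hasDerivWithinAt h'.continuousOn ht, h'.1, h'.2⟩

/-- Green's formula for the Wronskian of two functions. -/
theorem HasSecondDeriv.wronskian {u u' w v v' z : ℝ → ℂ} (h : HasSecondDeriv u u' w)
    (h2 : HasSecondDeriv v v' z) :
    IsPrimitive (fun t => u t * v' t - u' t * v t) (fun t => u t * z t - w t * v t) :=
  ((h.primitive.mul h2.primitive_deriv).sub (h.primitive_deriv.mul h2.primitive)).congr_deriv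
    fun t _ => by ring

/-- For two solutions with the same `lam` the integrand in Green's formula vanishes identically. -/
theorem IsSolution.wronskian_const {q : Potential} {lam : ℂ} {y y' z z' : ℝ → ℂ}
    (h : IsSolution q lam y y') (h2 : IsSolution q lam z z') {t : ℝ} (ht : t ∈ Icc (0 : ℝ) 1) :
    y t * z' t - y' t * z t = y 0 * z' 0 - y' 0 * z 0 := by
  have := (h.wronskian h2).2 t ht
  simp only at this
  rw [this, add_eq_left]
  refine (intervalIntegral.integral_congr (g := fun _ => 0) fun x _ => ?_).trans (by simp)
  ring

theorem IsSolution.lin {q : Potential} {lam : ℂ} {y y' z z' : ℝ → ℂ}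
    (h : IsSolution q lam y y') (h2 : IsSolution q lam z z') (c d : ℂ) :
    IsSolution q lam (fun t => c * y t + d * z t) (fun t => c * y' t + d * z' t) :=
  ((h.const_mul c).add (h2.const_mul d)).congr_ae (.of_forall fun t => by simp only; ring)

/-! ### Fundamental solutions and uniqueness for the initial value problem -/

section Fundamental

variable (q : Potential) (lam : ℂ)

theorem theta_isSolution : IsSolution q lam (theta q lam) (theta' q lam) :=
  (cauchySol_spec q lam 1 0).1

theorem phi_isSolution : IsSolution q lam (phi q lam) (phi' q lam) :=
  (cauchySol_spec q lam 0 1).1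

@[simp] theorem theta_zero : theta q lam 0 = 1 := (cauchySol_spec q lam 1 0).2.1
@[simp] theorem theta'_zero : theta' q lam 0 = 0 := (cauchySol_spec q lam 1 0).2.2
@[simp] theorem phi_zero : phi q lam 0 = 0 := (cauchySol_spec q lam 0 1).2.1
@[simp] theorem phi'_zero : phi' q lam 0 = 1 := (cauchySol_spec q lam 0 1).2.2

theorem wronskian_theta_phi {t : ℝ} (ht : t ∈ Icc (0 : ℝ) 1) :
    theta q lam t * phi' q lam t - theta' q lam t * phi q lam t = 1 := by
  rw [(theta_isSolution q lam).wronskian_const (phi_isSolution q lam) ht]; simp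

variable {q lam}

/-- The Wronskians of `y` with `φ` and with `ϑ` are constant and known at `0`. Solving these two
linear equations for `y t` uses only `W(ϑ, φ) = 1`, so uniqueness needs no Gronwall estimate. -/
theorem IsSolution.eq_comb {y y' : ℝ → ℂ} (h : IsSolution q lam y y') {t : ℝ}
    (ht : t ∈ Icc (0 : ℝ) 1) : y t = y 0 * theta q lam t + y' 0 * phi q lam t := by
  have h1 := h.wronskian_const (phi_isSolution q lam) ht
  have h2 := h.wronskian_const (theta_isSolution q lam) ht
  have h3 := wronskian_theta_phi q lam ht
  simp only [theta_zero, theta'_zero, phi_zero, phi'_zero] at h1 h2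
  linear_combination theta q lam t * h1 - phi q lam t * h2 - y t * h3

theorem IsSolution.deriv_eq_comb {y y' : ℝ → ℂ} (h : IsSolution q lam y y') {t : ℝ}
    (ht : t ∈ Icc (0 : ℝ) 1) : y' t = y 0 * theta' q lam t + y' 0 * phi' q lam t := by
  have h1 := h.wronskian_const (phi_isSolution q lam) ht
  have h2 := h.wronskian_const (theta_isSolution q lam) ht
  have h3 := wronskian_theta_phi q lam ht
  simp only [theta_zero, theta'_zero, phi_zero, phi'_zero] at h1 h2
  linear_combination theta' q lam t * h1 - phi' q lam t * h2 - y' t * h3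

end Fundamental

/-! ### Complex conjugation and Green's identity -/

theorem conj_intervalIntegral {w : ℝ → ℂ} (s t : ℝ) :
    (starRingEnd ℂ) (∫ x in s..t, w x) = ∫ x in s..t, (starRingEnd ℂ) (w x) := by
  simp only [intervalIntegral, map_sub, integral_conj]

theorem HasSecondDeriv.conj {u u' w : ℝ → ℂ} (h : HasSecondDeriv u u' w) :
    HasSecondDeriv (fun t => (starRingEnd ℂ) (u t)) (fun t => (starRingEnd ℂ) (u' t))
      (fun t => (starRingEnd ℂ) (w t)) := by
  refine ⟨fun t ht => ?_, ?_, fun t ht => ?_⟩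
  · exact (h.hasDeriv t ht).star
  · exact (Complex.conjLIE.toContinuousLinearEquiv : ℂ →L[ℝ] ℂ).integrable_comp h.integrable
  · rw [← conj_intervalIntegral, h.deriv_eq t ht, map_add]

theorem IsSolution.conj {q : Potential} {lam : ℂ} {y y' : ℝ → ℂ} (h : IsSolution q lam y y') :
    IsSolution q ((starRingEnd ℂ) lam) (fun t => (starRingEnd ℂ) (y t))
      (fun t => (starRingEnd ℂ) (y' t)) :=
  (HasSecondDeriv.conj h).congr_ae (.of_forall fun t => by simp)

section Reality

variable (q : Potential) (lam : ℝ) {t : ℝ}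

/-- For real `lam` the conjugate of `φ` solves the same equation with the same initial data. -/
theorem conj_phi' (ht : t ∈ Icc (0 : ℝ) 1) :
    (starRingEnd ℂ) (phi' q lam t) = phi' q lam t := by
  have := (phi_isSolution q lam).conj
  rw [Complex.conj_ofReal] at this
  simpa using this.deriv_eq_comb ht

end Reality

/-- Green's identity for a solution and its complex conjugate. -/
theorem IsSolution.conj_wronskian {q : Potential} {lam : ℂ} {y y' : ℝ → ℂ}
    (h : IsSolution q lam y y') :
    y 1 * (starRingEnd ℂ) (y' 1) - y' 1 * (starRingEnd ℂ) (y 1)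
      - (y 0 * (starRingEnd ℂ) (y' 0) - y' 0 * (starRingEnd ℂ) (y 0))
      = (lam - (starRingEnd ℂ) lam) * ((∫ x in (0 : ℝ)..1, ‖y x‖ ^ 2 : ℝ) : ℂ) := by
  have := (h.wronskian h.conj).2 1 one_mem_unit
  simp only at this
  rw [this, add_sub_cancel_left, ← intervalIntegral.integral_ofReal,
    ← intervalIntegral.integral_const_mul]
  refine intervalIntegral.integral_congr fun x _ => ?_
  push_cast
  rw [← Complex.mul_conj']
  ring

theorem integral_norm_sq_pos {y : ℝ → ℂ} (hy : ContinuousOn y (Icc 0 1)) {t : ℝ}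
    (ht : t ∈ Icc (0 : ℝ) 1) (h0 : y t ≠ 0) : 0 < ∫ x in (0 : ℝ)..1, ‖y x‖ ^ 2 :=
  intervalIntegral.integral_pos zero_lt_one (hy.norm.pow 2) (fun _ _ => by positivity)
    ⟨t, ht, by positivity⟩

theorem HasSecondDeriv.eqOn {u u' w v v' z : ℝ → ℂ} (h : HasSecondDeriv u u' w)
    (h2 : HasSecondDeriv v v' z) (huv : ∀ᵐ t ∂edgeMeasure, u t = v t) :
    EqOn u v (Icc 0 1) ∧ EqOn u' v' (Icc 0 1) := by
  have e1 : EqOn u v (Icc 0 1) :=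
    Measure.eqOn_Icc_of_ae_eq volume zero_ne_one huv h.continuousOn h2.continuousOn
  exact ⟨e1, fun t ht => (uniqueDiffOn_Icc zero_lt_one t ht).eq_deriv _ (h.hasDeriv t ht)
      ((h2.hasDeriv t ht).congr e1 (e1 ht))⟩

/-! ### Edge functions in `L²` and variation of constants -/

section EdgeFunctions

variable (q : Potential) (lam : ℂ)

theorem memLp_shifted_potential : MemLp (fun t => (q t : ℂ) - lam) 2 edgeMeasure :=
  (MemLp.ofReal (Lp.memLp q)).sub (memLp_const lam)

/-- The potential `q - lam` as an element of `L²(0,1)`. -/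
def shiftedPotential : EdgeL2 := (memLp_shifted_potential q lam).toLp _

theorem exists_edgeL2 {u : ℝ → ℂ} (hu : ContinuousOn u (Icc 0 1)) {K : ℝ}
    (hK : ∀ t ∈ Icc (0 : ℝ) 1, ‖u t‖ ≤ K) :
    ∃ f : EdgeL2, (∀ᵐ t ∂edgeMeasure, f t = u t) ∧ ‖f‖ ≤ K := by
  have hae : ∀ᵐ t ∂edgeMeasure, ‖u t‖ ≤ K := by
    filter_upwards [ae_restrict_mem measurableSet_Icc] with t ht using hK t ht
  have hm : MemLp u 2 edgeMeasure :=
    .of_bound (hu.aestronglyMeasurable measurableSet_Icc) K hae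
  refine ⟨hm.toLp u, hm.coeFn_toLp, ?_⟩
  have hK0 : 0 ≤ K := (norm_nonneg _).trans (hK 0 zero_mem_unit)
  have := Lp.norm_le_of_ae_bound (f := hm.toLp u) hK0 (by
    filter_upwards [hm.coeFn_toLp, hae] with t h1 h2
    rwa [h1])
  have h1 : measureUnivNNReal edgeMeasure = 1 := by simp [measureUnivNNReal]
  rwa [h1, NNReal.coe_one, Real.one_rpow, one_mul] at this

theorem exists_edgeL2_potential_mul {u : ℝ → ℂ} (hu : ContinuousOn u (Icc 0 1)) {K : ℝ}
    (hK : ∀ t ∈ Icc (0 : ℝ) 1, ‖u t‖ ≤ K) :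
    ∃ f : EdgeL2, (∀ᵐ t ∂edgeMeasure, f t = ((q t : ℂ) - lam) * u t) ∧
      ‖f‖ ≤ K * ‖shiftedPotential q lam‖ := by
  have hb : ∀ᵐ t ∂edgeMeasure, ‖((q t : ℂ) - lam) * u t‖ ≤ K * ‖(q t : ℂ) - lam‖ := by
    filter_upwards [ae_restrict_mem measurableSet_Icc] with t ht
    rw [norm_mul, mul_comm]
    exact mul_le_mul_of_nonneg_right (hK t ht) (norm_nonneg _)
  have hm : MemLp (fun t => ((q t : ℂ) - lam) * u t) 2 edgeMeasure :=
    (memLp_shifted_potential q lam).of_le_mul ((memLp_shifted_potential q lam).1.mul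
      (hu.aestronglyMeasurable measurableSet_Icc)) hb
  refine ⟨hm.toLp _, hm.coeFn_toLp, Lp.norm_le_mul_norm_of_ae_le_mul ?_⟩
  filter_upwards [hb, hm.coeFn_toLp, (memLp_shifted_potential q lam).coeFn_toLp] with t h1 h2 h3
  rw [h2, shiftedPotential, h3]
  exact h1

/-- Variation of constants: the solution of `-v'' + (q - lam) v = g` with zero initial data is
bounded by `g`. -/
theorem exists_particular_solution : ∃ C : ℝ, 0 ≤ C ∧ ∀ g : EdgeL2, ∃ v v' : ℝ → ℂ,
    HasSecondDeriv v v' (fun t => ((q t : ℂ) - lam) * v t - g t) ∧ v 0 = 0 ∧ v' 0 = 0 ∧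
      (∀ t ∈ Icc (0 : ℝ) 1, ‖v t‖ ≤ C * ‖g‖) ∧ ‖v' 1‖ ≤ C * ‖g‖ := by
  have hθ := theta_isSolution q lam
  have hφ := phi_isSolution q lam
  have hbd : ∀ {y : ℝ → ℂ}, ContinuousOn y (Icc 0 1) →
      ∃ M : ℝ, ∀ t ∈ Icc (0 : ℝ) 1, ‖y t‖ ≤ M :=
    fun hy => isCompact_Icc.exists_bound_of_continuousOn hy
  obtain ⟨M1, h1⟩ := hbd hθ.continuousOn
  obtain ⟨M2, h2⟩ := hbd hφ.continuousOn
  obtain ⟨M3, h3⟩ := hbd hθ.primitive_deriv.continuousOn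
  obtain ⟨M4, h4⟩ := hbd hφ.primitive_deriv.continuousOn
  have p1 := (norm_nonneg _).trans (h1 0 zero_mem_unit)
  have p2 := (norm_nonneg _).trans (h2 0 zero_mem_unit)
  have p3 := (norm_nonneg _).trans (h3 0 zero_mem_unit)
  have p4 := (norm_nonneg _).trans (h4 0 zero_mem_unit)
  -- The first two products bound `v`, the last two bound `v'`; one constant serves for both.
  refine ⟨M1 * M2 + M2 * M1 + (M3 * M2 + M4 * M1), by positivity, fun g => ?_⟩
  have hg : IntegrableOn g (Icc 0 1) := (Lp.memLp g).integrable (by norm_num)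
  have key : ∀ {y : ℝ → ℂ} {M : ℝ}, ContinuousOn y (Icc 0 1) →
      (∀ t ∈ Icc (0 : ℝ) 1, ‖y t‖ ≤ M) →
      IsPrimitive (fun t => ∫ x in (0 : ℝ)..t, y x * g x) (fun x => y x * g x) ∧
      ∀ t ∈ Icc (0 : ℝ) 1, ‖∫ x in (0 : ℝ)..t, y x * g x‖ ≤ M * ‖g‖ := by
    intro y M hy hM
    have hM0 := (norm_nonneg _).trans (hM 0 zero_mem_unit)
    have hi : IntegrableOn (fun x => y x * g x) (Icc 0 1) :=
      hg.continuousOn_mul hy isCompact_Icc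
    refine ⟨⟨hi, fun t _ => by simp⟩, fun t ht => ?_⟩
    rw [intervalIntegral.integral_of_le ht.1]
    refine (norm_integral_le_integral_norm _).trans ?_
    refine (setIntegral_mono_set hi.norm (.of_forall fun _ => norm_nonneg _)
      (.of_forall fun x hx => ⟨hx.1.le, hx.2.trans ht.2⟩ :
        Ioc 0 t ≤ᵐ[volume] Icc (0 : ℝ) 1)).trans ?_
    refine (setIntegral_mono_on hi.norm (hg.norm.const_mul M) measurableSet_Icc
      fun x hx => ?_).trans ?_
    · rw [norm_mul]
      exact mul_le_mul_of_nonneg_right (hM x hx) (norm_nonneg _)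
    · rw [integral_const_mul]
      exact mul_le_mul_of_nonneg_left (integral_norm_le g) hM0
  obtain ⟨a1, b1⟩ := key hθ.continuousOn h1
  obtain ⟨a2, b2⟩ := key hφ.continuousOn h2
  set J := fun t => ∫ x in (0 : ℝ)..t, theta q lam x * g x
  set I := fun t => ∫ x in (0 : ℝ)..t, phi q lam x * g x
  have comb : ∀ {y z : ℝ → ℂ} {A B : ℝ}, (∀ t ∈ Icc (0 : ℝ) 1, ‖y t‖ ≤ A) →
      (∀ t ∈ Icc (0 : ℝ) 1, ‖z t‖ ≤ B) → ∀ t ∈ Icc (0 : ℝ) 1,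
      ‖y t * I t - z t * J t‖ ≤ (A * M2 + B * M1) * ‖g‖ := by
    intro y z A B hA hB t ht
    have pA := (norm_nonneg _).trans (hA t ht)
    have pB := (norm_nonneg _).trans (hB t ht)
    calc ‖y t * I t - z t * J t‖ ≤ ‖y t‖ * ‖I t‖ + ‖z t‖ * ‖J t‖ := by
          rw [← norm_mul, ← norm_mul]; exact norm_sub_le _ _
      _ ≤ A * (M2 * ‖g‖) + B * (M1 * ‖g‖) := by
          gcongr
          exacts [hA t ht, b2 t ht, hB t ht, b1 t ht]
      _ = _ := by ring
  -- Here `I = ∫ φ g` and `J = ∫ ϑ g`. The terms with `g` cancel in the first derivative, and in the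
  -- second they give `-g` times the Wronskian.
  refine ⟨fun t => theta q lam t * I t - phi q lam t * J t,
    fun t => theta' q lam t * I t - phi' q lam t * J t, .of_primitive ?_ ?_, ?_, ?_, ?_, ?_⟩
  · refine ((hθ.primitive.mul a2).sub (hφ.primitive.mul a1)).congr_deriv fun t _ => ?_
    ring
  · refine ((hθ.primitive_deriv.mul a2).sub (hφ.primitive_deriv.mul a1)).congr_deriv
      fun t ht => ?_
    have := wronskian_theta_phi q lam ht
    simp only
    linear_combination (-g t) * this
  · simp [I, J]
  · simp [I, J]
  · intro t ht
    refine (comb h1 h2 t ht).trans ?_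
    exact mul_le_mul_of_nonneg_right (le_add_of_nonneg_right (by positivity)) (norm_nonneg g)
  · refine (comb h3 h4 1 one_mem_unit).trans ?_
    exact mul_le_mul_of_nonneg_right (le_add_of_nonneg_left (by positivity)) (norm_nonneg g)

end EdgeFunctions

/-! ### Square summable sequences and functions on the graph -/

section SequenceSpaces

theorem lp_two_norm_sq {ι : Type*} {E : ι → Type*} [∀ i, NormedAddCommGroup (E i)]
    (f : lp E 2) : Summable (fun i => ‖f i‖ ^ 2) ∧ ∑' i, ‖f i‖ ^ 2 = ‖f‖ ^ 2 := by
  have h := lp.hasSum_norm (p := 2) (by norm_num) f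
  simp only [ENNReal.toReal_ofNat, Real.rpow_ofNat] at h
  exact ⟨h.summable, h.tsum_eq⟩

/-- A function on the edges dominated by the values of a square summable sequence at the
neighbouring cells is square summable. -/
theorem memlp_of_le_neighbours {E : Type*} [NormedAddCommGroup E] {f : ℤ × Fin 3 → E} {N : ℤ → ℝ}
    (hS : Summable fun n => N n ^ 2) {C : ℝ}
    (h : ∀ n j, ‖f (n, j)‖ ≤ C * (N (n - 1) + N n + N (n + 1))) :
    Memℓp f 2 ∧ ∑' α, ‖f α‖ ^ 2 ≤ 27 * C ^ 2 * ∑' n, N n ^ 2 := by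
  have s1 : HasSum (fun n => N (n - 1) ^ 2) (∑' n, N n ^ 2) :=
    (Equiv.hasSum_iff (f := fun n => N n ^ 2) (Equiv.subRight (1 : ℤ))).2 hS.hasSum
  have s2 : HasSum (fun n => N (n + 1) ^ 2) (∑' n, N n ^ 2) :=
    (Equiv.hasSum_iff (f := fun n => N n ^ 2) (Equiv.addRight (1 : ℤ))).2 hS.hasSum
  -- The factor `9` is `3` from `(a + b + c)² ≤ 3 (a² + b² + c²)` times the `3` edges of a cell. The
  -- three shifted sums have equal totals, which leads to `27`.
  have s := ((s1.add hS.hasSum).add s2).mul_left (9 * C ^ 2)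
  have hb : ∀ n j, ‖f (n, j)‖ ^ 2 ≤
      3 * C ^ 2 * (N (n - 1) ^ 2 + N n ^ 2 + N (n + 1) ^ 2) := by
    intro n j
    refine (pow_le_pow_left₀ (norm_nonneg _) (h n j) 2).trans ?_
    rw [mul_pow, mul_comm 3, mul_assoc]
    refine mul_le_mul_of_nonneg_left ?_ (sq_nonneg C)
    nlinarith [sq_nonneg (N (n - 1) - N n), sq_nonneg (N (n - 1) - N (n + 1)),
      sq_nonneg (N n - N (n + 1))]
  have hb3 : ∀ n, ∑' j, ‖f (n, j)‖ ^ 2 ≤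
      9 * C ^ 2 * (N (n - 1) ^ 2 + N n ^ 2 + N (n + 1) ^ 2) := by
    intro n
    rw [tsum_fintype, Fin.sum_univ_three]
    linarith [hb n 0, hb n 1, hb n 2]
  have hs3 : Summable fun n => ∑' j, ‖f (n, j)‖ ^ 2 :=
    .of_nonneg_of_le (fun n => tsum_nonneg fun _ => by positivity) hb3 s.summable
  have hsum : Summable fun α => ‖f α‖ ^ 2 :=
    (summable_prod_of_nonneg fun α => sq_nonneg ‖f α‖).2 ⟨fun _ => Summable.of_finite, hs3⟩
  refine ⟨memℓp_gen ?_, ?_⟩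
  · simpa only [ENNReal.toReal_ofNat, Real.rpow_ofNat] using hsum
  rw [hsum.tsum_prod' fun _ => Summable.of_finite]
  refine (hs3.tsum_le_tsum hb3 s.summable).trans ?_
  rw [s.tsum_eq]
  linarith

/-- The norm of the restriction of a graph function to the cell `n`. -/
def cellNorm (g : GraphL2) (n : ℤ) : ℝ := ‖g (n, 0)‖ + ‖g (n, 1)‖ + ‖g (n, 2)‖

theorem cellNorm_nonneg (g : GraphL2) (n : ℤ) : 0 ≤ cellNorm g n := by
  unfold cellNorm; positivity

theorem norm_le_cellNorm (g : GraphL2) (n : ℤ) (j : Fin 3) : ‖g (n, j)‖ ≤ cellNorm g n := by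
  have h0 := norm_nonneg (g (n, 0))
  have h1 := norm_nonneg (g (n, 1))
  have h2 := norm_nonneg (g (n, 2))
  unfold cellNorm
  fin_cases j <;> simp only [Fin.zero_eta, Fin.mk_one, Fin.reduceFinMk] <;> linarith

theorem summable_cellNorm_sq (g : GraphL2) :
    Summable (fun n => cellNorm g n ^ 2) ∧ ∑' n, cellNorm g n ^ 2 ≤ 3 * ‖g‖ ^ 2 := by
  obtain ⟨hs, he⟩ := lp_two_norm_sq g
  have hs3 := hs.prod
  have hb : ∀ n, cellNorm g n ^ 2 ≤ 3 * ∑' j, ‖g (n, j)‖ ^ 2 := by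
    intro n
    rw [tsum_fintype, Fin.sum_univ_three]
    unfold cellNorm
    nlinarith [sq_nonneg (‖g (n, 0)‖ - ‖g (n, 1)‖), sq_nonneg (‖g (n, 0)‖ - ‖g (n, 2)‖),
      sq_nonneg (‖g (n, 1)‖ - ‖g (n, 2)‖)]
  have hsum := Summable.of_nonneg_of_le (fun n => sq_nonneg (cellNorm g n)) hb (hs3.mul_left 3)
  refine ⟨hsum, (hsum.tsum_le_tsum hb (hs3.mul_left 3)).trans ?_⟩
  rw [tsum_mul_left, ← he, hs.tsum_prod' fun _ => Summable.of_finite]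

/-- The map that sends a sequence `x` to the graph function with components
`x n • P j + x (n + 1) • Q j`. -/
def cellSynthesis (P Q : Fin 3 → EdgeL2) : lp (fun _ : ℤ => ℂ) 2 →L[ℂ] GraphL2 :=
  have key (x : lp (fun _ : ℤ => ℂ) 2) :
      Memℓp (fun α : ℤ × Fin 3 => x α.1 • P α.2 + x (α.1 + 1) • Q α.2) 2 ∧
      ∑' α : ℤ × Fin 3, ‖x α.1 • P α.2 + x (α.1 + 1) • Q α.2‖ ^ 2 ≤
        27 * (∑ j, (‖P j‖ + ‖Q j‖)) ^ 2 * ‖x‖ ^ 2 := by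
    rw [← (lp_two_norm_sq x).2]
    refine memlp_of_le_neighbours (lp_two_norm_sq x).1 fun n j => ?_
    have hj := Finset.single_le_sum (f := fun j => ‖P j‖ + ‖Q j‖)
      (fun i _ => by positivity) (Finset.mem_univ j)
    have hP : ‖P j‖ ≤ ∑ j, (‖P j‖ + ‖Q j‖) := by linarith [norm_nonneg (Q j)]
    have hQ : ‖Q j‖ ≤ ∑ j, (‖P j‖ + ‖Q j‖) := by linarith [norm_nonneg (P j)]
    refine (norm_add_le _ _).trans ?_
    rw [norm_smul, norm_smul]
    have h1 := mul_le_mul_of_nonneg_left hP (norm_nonneg (x n))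
    have h2 := mul_le_mul_of_nonneg_left hQ (norm_nonneg (x (n + 1)))
    have h3 := mul_nonneg ((norm_nonneg _).trans hP) (norm_nonneg (x (n - 1)))
    linarith
  LinearMap.mkContinuous
    { toFun := fun x => ⟨fun α => x α.1 • P α.2 + x (α.1 + 1) • Q α.2, (key x).1⟩
      map_add' := fun x y => by
        ext α : 2
        simp only [lp.coeFn_add, Pi.add_apply]
        module
      map_smul' := fun c x => by
        ext α : 2
        simp only [lp.coeFn_smul, Pi.smul_apply, smul_eq_mul, RingHom.id_apply]
        module }
    -- The constant `6` is chosen because `27 ≤ 6²`.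
    (6 * ∑ j, (‖P j‖ + ‖Q j‖)) fun x => by
      have h0 : 0 ≤ ∑ j, (‖P j‖ + ‖Q j‖) := Finset.sum_nonneg fun j _ => by positivity
      refine abs_le_of_sq_le_sq' ?_ (by positivity) |>.2
      rw [← (lp_two_norm_sq _).2]
      refine (key x).2.trans ?_
      nlinarith [mul_nonneg (sq_nonneg (∑ j, (‖P j‖ + ‖Q j‖))) (sq_nonneg ‖x‖)]

theorem cellSynthesis_apply (P Q : Fin 3 → EdgeL2) (x : lp (fun _ : ℤ => ℂ) 2) (n : ℤ)
    (j : Fin 3) : cellSynthesis P Q x (n, j) = x n • P j + x (n + 1) • Q j := rfl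

/-- As `Q 0 = 0`, the edge `(n,0)` carries `x n • P 0` alone, and these edges already account for
the whole norm of `x`. This gives both injectivity of the synthesis and the bound for its inverse.
-/
theorem norm_le_norm_cellSynthesis (P Q : Fin 3 → EdgeL2) (hQ : Q 0 = 0)
    (x : lp (fun _ : ℤ => ℂ) 2) : ‖P 0‖ * ‖x‖ ≤ ‖cellSynthesis P Q x‖ := by
  refine abs_le_of_sq_le_sq' ?_ (norm_nonneg _) |>.2
  rw [mul_pow, ← (lp_two_norm_sq x).2, ← (lp_two_norm_sq (cellSynthesis P Q x)).2,
    ← tsum_mul_left]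
  have hs := (lp_two_norm_sq (cellSynthesis P Q x)).1
  have hinj : Function.Injective fun n : ℤ => (n, (0 : Fin 3)) := fun m n h => congrArg Prod.fst h
  refine le_trans (le_of_eq (tsum_congr fun n => ?_))
    (tsum_comp_le_tsum_of_inj hs (fun _ => sq_nonneg _) hinj)
  simp [Function.comp, cellSynthesis_apply, hQ, norm_smul, mul_pow, mul_comm]

theorem not_finiteDimensional_lp_int :
    ¬ FiniteDimensional ℂ (lp (fun _ : ℤ => ℂ) 2) := by
  intro h
  have hli : LinearIndependent ℂ
      fun n : ℤ => (lp.single 2 n (1 : ℂ) : lp (fun _ : ℤ => ℂ) 2) := by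
    rw [linearIndependent_iff']
    intro s g hg i hi
    have := congrArg (fun x : lp (fun _ : ℤ => ℂ) 2 => x i) hg
    simp only [lp.coeFn_sum, Finset.sum_apply, lp.coeFn_smul, Pi.smul_apply, smul_eq_mul,
      lp.coeFn_zero, Pi.zero_apply, lp.single_apply] at this
    simpa [Pi.single_apply, hi] using this
  exact not_finite_iff_infinite.2 inferInstance hli.finite

end SequenceSpaces

/-! ### Phases and the constants of the vertex system -/

section Constants

theorem phase_ne_zero (a : ℝ) : phase a ≠ 0 := Complex.exp_ne_zero _

theorem phase_neg (a : ℝ) : phase (-a) = (phase a)⁻¹ := by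
  rw [phase, phase, ← Complex.exp_neg]
  push_cast
  ring_nf

theorem conj_phase (a : ℝ) : (starRingEnd ℂ) (phase a) = (phase a)⁻¹ := by
  rw [← phase_neg, phase, phase, ← Complex.exp_conj]
  simp

/-- The product `e^{2ia} s^k` is `e^{2ix}` with `x = a + πk/N`; when `cos x = 0` the double angle
formulas give `-1`. The condition `c_k = 0` enters the proof only in this form. -/
theorem phase_mul_sPow {N : ℕ} {k : ℤ} {a : ℝ} (hc : Real.cos (a + Real.pi * k / N) = 0) :
    phase a * sPow N k = -(phase a)⁻¹ := by
  have h : phase a ^ 2 * sPow N k = -1 := by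
    set x : ℝ := a + Real.pi * k / N with hx
    have e : phase a ^ 2 * sPow N k = Complex.exp ((2 * x : ℝ) * Complex.I) := by
      rw [phase, sPow, ← Complex.exp_nat_mul, ← Complex.exp_int_mul, ← Complex.exp_add]
      congr 1
      rw [hx]
      push_cast
      ring
    rw [e, Complex.exp_mul_I, ← Complex.ofReal_cos, ← Complex.ofReal_sin, Real.cos_two_mul,
      Real.sin_two_mul, hc]
    simp
  have := phase_ne_zero a
  field_simp
  linear_combination h

/-- The constant `ϑ(1) + 2 Δ`. -/
def constThree (q : Potential) (lam : ℂ) : ℂ := theta q lam 1 + 2 * lyapunov q lam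

variable (q : Potential) (lam : ℂ)

/-- Both sides differ by a multiple of the Wronskian identity. This is what connects solvability of
the vertex system with the function `F`. -/
theorem constOne_mul_constThree : constOne q lam * constThree q lam = 4 * bigF q lam + 5 := by
  have := wronskian_theta_phi q lam one_mem_unit
  simp only [constOne, constThree, bigF, lyapunov]
  linear_combination this

theorem bigF_eq_neg_one_iff : bigF q lam = -1 ↔ constOne q lam * constThree q lam = 1 := by
  rw [constOne_mul_constThree]
  constructor
  · intro h; rw [h]; norm_num
  · intro h; linear_combination h / 4

variable {q lam}

/-- In this form `C₂` is recognised as the initial slope on an edge `(n,0)` with start value `C₁`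
and end value `1`. -/
theorem phi_mul_constTwo (h : phi q lam 1 ≠ 0) :
    phi q lam 1 * constTwo q lam = 1 - theta q lam 1 * constOne q lam := by
  have := wronskian_theta_phi q lam one_mem_unit
  rw [constTwo, constOne]
  field_simp
  linear_combination this

end Constants

/-! ### Reduction of the vertex conditions to a recurrence -/

section Vertex

variable {q : Potential} {lam : ℂ} {N : ℕ} {k : ℤ} {a : ℝ}

theorem IsSolution.phi_mul_deriv_zero {y y' : ℝ → ℂ} (h : IsSolution q lam y y') :
    phi q lam 1 * y' 0 = y 1 - theta q lam 1 * y 0 := by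
  rw [h.eq_comb one_mem_unit]; ring

theorem IsSolution.phi_mul_deriv_one {y y' : ℝ → ℂ} (h : IsSolution q lam y y') :
    phi q lam 1 * y' 1 = phi' q lam 1 * y 1 - y 0 := by
  rw [h.eq_comb one_mem_unit, h.deriv_eq_comb one_mem_unit]
  linear_combination (-y 0) * wronskian_theta_phi q lam one_mem_unit

/-- The recurrence relations for the vertex values of a solution. -/
theorem Kirchhoff.vertex_relations (hm : phase a * sPow N k = -(phase a)⁻¹)
    {u u' : ℤ → Fin 3 → ℝ → ℂ} (hk : Kirchhoff N k a u u')
    (hs : ∀ n j, IsSolution q lam (u n j) (u' n j)) (n : ℤ) :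
    u n 0 0 = constOne q lam * u n 1 0 ∧ u n 1 0 = constThree q lam * u n 0 0 := by
  -- Each flux condition is multiplied by `φ(1)`, so that slopes turn into end values without
  -- division. In the first, edge `1` contributes `(phase a)⁻¹ * u n 2 0` and edge `2` contributes
  -- its negative.
  have hp : phase a * (phase a)⁻¹ = 1 := mul_inv_cancel₀ (phase_ne_zero a)
  constructor
  · have c1 := hk.cont_one n
    have c2 := hk.cont_two n
    have c4 := hk.cont_four n
    have f1 := hk.flux_one n
    rw [hm] at c2 f1
    rw [constOne, lyapunov]
    linear_combination phi q lam 1 * f1 + phi' q lam 1 * c1 - phi' q lam 1 * c2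
      + u n 1 1 * hp - (phase a)⁻¹ * c4 + (hs n 0).phi_mul_deriv_one
      - (hs n 1).phi_mul_deriv_zero - (phase a)⁻¹ * (hs n 2).phi_mul_deriv_one
  -- The second vertex of cell `m` is where edge `(m + 1, 0)` starts, hence the shift.
  · obtain ⟨m, rfl⟩ : ∃ m, n = m + 1 := ⟨n - 1, by ring⟩
    have c1 := hk.cont_one (m + 1)
    have c2 := hk.cont_two m
    have c3 := hk.cont_three m
    have c4 := hk.cont_four m
    have f2 := hk.flux_two m
    rw [hm] at c2
    rw [constThree, lyapunov]
    linear_combination phi q lam 1 * f2 - c1 - phi' q lam 1 * c3 - phase a * c2 + u m 2 1 * hp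
      - theta q lam 1 * (c3 + c4) - (hs (m + 1) 0).phi_mul_deriv_zero
      + phase a * (hs m 1).phi_mul_deriv_one - (hs m 2).phi_mul_deriv_zero

/-- The values at the initial points of the edges, in terms of the vertex values. -/
def startValue (x y : ℤ → ℂ) (n : ℤ) : Fin 3 → ℂ := ![y (n - 1), x n, y n]

/-- The values at the end points of the edges, in terms of the vertex values. -/
def endValue (a : ℝ) (x y : ℤ → ℂ) (n : ℤ) : Fin 3 → ℂ :=
  ![x n, (phase a)⁻¹ * y n, -phase a * x n]

/-- The multiple of `φ` that has to be added in order to obtain prescribed end values. -/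
def startSlope (q : Potential) (lam : ℂ) (a : ℝ) (v : ℤ → Fin 3 → ℝ → ℂ) (x y : ℤ → ℂ) (n : ℤ)
    (j : Fin 3) : ℂ :=
  (endValue a x y n j - v n j 1 - theta q lam 1 * startValue x y n j) / phi q lam 1

/-- Vertex values that satisfy the recurrence relations give rise to a function with the vertex
conditions. -/
theorem kirchhoff_of_vertex_values (hm : phase a * sPow N k = -(phase a)⁻¹)
    (hφ : phi q lam 1 ≠ 0) {v v' : ℤ → Fin 3 → ℝ → ℂ} (hv : ∀ n j, v n j 0 = 0)
    (hv' : ∀ n j, v' n j 0 = 0) {x y : ℤ → ℂ}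
    (h1 : ∀ n, y (n - 1) = constOne q lam * x n
      + (phi q lam 1 * (v' n 0 1 - (phase a)⁻¹ * v' n 2 1)
        - phi' q lam 1 * (v n 0 1 - (phase a)⁻¹ * v n 2 1) + v n 1 1))
    (h2 : ∀ n, x n = constThree q lam * y (n - 1)
      + (v n 0 1 + phase a * (phi q lam 1 * v' (n - 1) 1 1 - phi' q lam 1 * v (n - 1) 1 1)
        + v (n - 1) 2 1)) :
    Kirchhoff N k a
      (fun n j t => startValue x y n j * theta q lam t
        + startSlope q lam a v x y n j * phi q lam t + v n j t)
      (fun n j t => startValue x y n j * theta' q lam t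
        + startSlope q lam a v x y n j * phi' q lam t + v' n j t) := by
  have hp := phase_ne_zero a
  have hW := wronskian_theta_phi q lam one_mem_unit
  have hend : ∀ n j, startValue x y n j * theta q lam 1
      + startSlope q lam a v x y n j * phi q lam 1 + v n j 1 = endValue a x y n j := by
    intro n j
    rw [startSlope]
    field_simp
    ring
  have hd0 : ∀ n j, phi q lam 1 * startSlope q lam a v x y n j =
      endValue a x y n j - v n j 1 - theta q lam 1 * startValue x y n j := by
    intro n j
    rw [startSlope]
    field_simp
  have hd1 : ∀ n j, phi q lam 1 * (startValue x y n j * theta' q lam 1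
      + startSlope q lam a v x y n j * phi' q lam 1 + v' n j 1) =
      phi' q lam 1 * (endValue a x y n j - v n j 1) - startValue x y n j
        + phi q lam 1 * v' n j 1 := by
    intro n j
    linear_combination phi' q lam 1 * hd0 n j - startValue x y n j * hW
  refine ⟨fun n => ?_, fun n => ?_, fun n => ?_, fun n => ?_, fun n => ?_, fun n => ?_⟩
  · rw [hend]; simp [hv, startValue, endValue]
  · rw [hend, hm]; simp [hv, startValue, endValue, hp]
  · rw [hend]; simp [hv, startValue, endValue, hp]
  · rw [hend]; simp [hv, startValue, endValue, hp]
  · have e1 := hd1 n 0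
    have e2 := hd0 n 1
    have e3 := hd1 n 2
    rw [hm]
    -- The slopes are known in closed form after multiplication by `φ(1)`; the flux condition then
    -- becomes the hypothesis `h1`.
    refine (mul_eq_zero_iff_left hφ).1 ?_
    simp only [theta'_zero, phi'_zero, hv', startValue, endValue, Matrix.cons_val_zero,
      Matrix.cons_val_one, Matrix.cons_val] at e1 e2 e3 ⊢
    have h := h1 n
    rw [constOne, lyapunov] at h
    have hpp : phase a * (phase a)⁻¹ = 1 := mul_inv_cancel₀ hp
    linear_combination -e1 + e2 + (phase a)⁻¹ * e3 + h - phi' q lam 1 * x n * hpp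
  · have e1 := hd0 (n + 1) 0
    have e2 := hd1 n 1
    have e3 := hd0 n 2
    refine (mul_eq_zero_iff_left hφ).1 ?_
    have h := h2 (n + 1)
    simp only [theta'_zero, phi'_zero, hv', startValue, endValue, Matrix.cons_val_zero,
      Matrix.cons_val_one, Matrix.cons_val, add_sub_cancel_right] at e1 e2 e3 h ⊢
    rw [constThree, lyapunov] at h
    have hpp : phase a * (phase a)⁻¹ = 1 := mul_inv_cancel₀ hp
    linear_combination e1 - phase a * e2 + e3 + h - phi' q lam 1 * y n * hpp

end Vertex

/-! ### Localised solutions -/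

section LocalFamily

/-- Coefficients of a localised solution: its values on the cell `0` are
`valueZero j * ϑ + slopeZero j * φ`, those on the cell `-1` are
`valueNeg j * ϑ + slopeNeg j * φ`, and all superpositions of its translates satisfy the vertex
conditions. -/
structure LocalSolution (q : Potential) (N : ℕ) (k : ℤ) (a : ℝ) (lam : ℂ) where
  valueZero : Fin 3 → ℂ
  slopeZero : Fin 3 → ℂ
  valueNeg : Fin 3 → ℂ
  slopeNeg : Fin 3 → ℂ
  valueNeg_zero : valueNeg 0 = 0
  slopeNeg_zero : slopeNeg 0 = 0
  ne_zero : valueZero 0 ≠ 0 ∨ slopeZero 0 ≠ 0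
  kirchhoff : ∀ x : ℤ → ℂ, Kirchhoff N k a
    (fun n j t => (x n * valueZero j + x (n + 1) * valueNeg j) * theta q lam t
      + (x n * slopeZero j + x (n + 1) * slopeNeg j) * phi q lam t)
    (fun n j t => (x n * valueZero j + x (n + 1) * valueNeg j) * theta' q lam t
      + (x n * slopeZero j + x (n + 1) * slopeNeg j) * phi' q lam t)

variable {q : Potential} {lam : ℂ} {N : ℕ} {k : ℤ} {a : ℝ}

theorem IsSolution.fundamental (c d : ℂ) :
    IsSolution q lam (fun t => c * theta q lam t + d * phi q lam t)
      (fun t => c * theta' q lam t + d * phi' q lam t) :=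
  (theta_isSolution q lam).lin (phi_isSolution q lam) c d

/-- The localised solution at the energies with `F = -1`. -/
def antiperiodicSolution (hm : phase a * sPow N k = -(phase a)⁻¹) (hφ : phi q lam 1 ≠ 0)
    (hF : constOne q lam * constThree q lam = 1) : LocalSolution q N k a lam where
  valueZero := ![constOne q lam, 1, 0]
  slopeZero := ![constTwo q lam, -(theta q lam 1 / phi q lam 1), -(phase a / phi q lam 1)]
  valueNeg := ![0, 0, constOne q lam]
  slopeNeg := ![0, (phase a)⁻¹ * constOne q lam / phi q lam 1,
    -(theta q lam 1 / phi q lam 1 * constOne q lam)]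
  valueNeg_zero := rfl
  slopeNeg_zero := rfl
  ne_zero := .inl fun h => by
    simp only [Matrix.cons_val_zero] at h
    simp [h] at hF
  kirchhoff x := by
    -- With no source term, the choice `y n = C₁ x (n + 1)` satisfies the first recurrence by
    -- definition and the second because `C₁C₃ = 1`. So `x` stays arbitrary.
    have := kirchhoff_of_vertex_values (q := q) (lam := lam) (N := N) (k := k) (a := a) hm hφ
      (v := fun _ _ _ => 0) (v' := fun _ _ _ => 0) (fun _ _ => rfl) (fun _ _ => rfl) (x := x)
      (y := fun n => constOne q lam * x (n + 1)) (fun n => by simp)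
      (fun n => by
        simp only [sub_add_cancel]
        linear_combination -x n * hF)
    have h2 : constTwo q lam = (1 - theta q lam 1 * constOne q lam) / phi q lam 1 := by
      rw [← phi_mul_constTwo hφ]; field_simp
    have e1 : ∀ n j, startValue x (fun n => constOne q lam * x (n + 1)) n j =
        x n * ![constOne q lam, 1, 0] j + x (n + 1) * ![0, 0, constOne q lam] j := by
      intro n j
      fin_cases j <;> simp [startValue, mul_comm]
    have e2 : ∀ n j, startSlope q lam a (fun _ _ _ => 0) x
        (fun n => constOne q lam * x (n + 1)) n j =
        x n * ![constTwo q lam, -(theta q lam 1 / phi q lam 1), -(phase a / phi q lam 1)] j +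
          x (n + 1) * ![0, (phase a)⁻¹ * constOne q lam / phi q lam 1,
            -(theta q lam 1 / phi q lam 1 * constOne q lam)] j := by
      intro n j
      rw [startSlope, e1, h2]
      fin_cases j <;> simp [endValue] <;> ring
    simpa only [e1, e2, add_zero] using this

/-- The localised solution at the Dirichlet eigenvalues. -/
def dirichletSolution (hm : phase a * sPow N k = -(phase a)⁻¹) (hφ : phi q lam 1 = 0)
    (hx : phi' q lam 1 ^ 2 + 1 ≠ 0) : LocalSolution q N k a lam where
  -- All vertex values vanish, so only the flux conditions matter. The slope on edge `(0,0)` is set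
  -- to `1`; on each of the cells `0` and `-1` the slopes on edges `1` and `2` then solve a 2×2
  -- system of determinant `φ'(1)² + 1`.
  valueZero := 0
  slopeZero := ![1, phi' q lam 1 / (phi' q lam 1 ^ 2 + 1),
    phase a * phi' q lam 1 ^ 2 / (phi' q lam 1 ^ 2 + 1)]
  valueNeg := 0
  slopeNeg := ![0, (phase a)⁻¹ * phi' q lam 1 / (phi' q lam 1 ^ 2 + 1),
    -(1 / (phi' q lam 1 ^ 2 + 1))]
  valueNeg_zero := rfl
  slopeNeg_zero := rfl
  ne_zero := .inr one_ne_zero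
  kirchhoff x := by
    have hp := phase_ne_zero a
    refine ⟨fun n => ?_, fun n => ?_, fun n => ?_, fun n => ?_, fun n => ?_, fun n => ?_⟩
    · simp [hφ]
    · simp [hφ]
    · simp [hφ]
    · simp [hφ]
    · rw [hm]
      simp
      field_simp
      ring
    · simp
      field_simp
      ring

end LocalFamily

/-! ### Symmetry of the vertex conditions and reality of the energies -/

section Symmetry

variable {q : Potential} {lam : ℂ} {N : ℕ} {k : ℤ} {a : ℝ}

/-- The boundary form of Green's identity. -/
def boundaryForm (y y' : ℝ → ℂ) (t : ℝ) : ℂ :=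
  y t * (starRingEnd ℂ) (y' t) - y' t * (starRingEnd ℂ) (y t)

/-- At each vertex the values agree up to unimodular phases, the slopes carry the same phases, and
conjugation inverts a phase. The signed boundary forms therefore add up to the common value paired
with the total flux. -/
theorem Kirchhoff.boundaryForm_eq_zero (hm : phase a * sPow N k = -(phase a)⁻¹)
    {u u' : ℤ → Fin 3 → ℝ → ℂ} (hk : Kirchhoff N k a u u') (n : ℤ) :
    boundaryForm (u n 0) (u' n 0) 1 - boundaryForm (u n 1) (u' n 1) 0
        + boundaryForm (u n 2) (u' n 2) 1 = 0 ∧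
      boundaryForm (u (n + 1) 0) (u' (n + 1) 0) 0 - boundaryForm (u n 1) (u' n 1) 1
        + boundaryForm (u n 2) (u' n 2) 0 = 0 := by
  have hp := phase_ne_zero a
  have hpp : phase a * (phase a)⁻¹ = 1 := mul_inv_cancel₀ hp
  constructor
  · have c1 := hk.cont_one n
    have c2 : u n 2 1 = -phase a * u n 1 0 := by
      have := hk.cont_two n
      rw [hm] at this
      rw [this]
      field_simp
    have f1 : u' n 0 1 = u' n 1 0 + (phase a)⁻¹ * u' n 2 1 := by
      have := hk.flux_one n
      rw [hm] at this
      linear_combination -this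
    simp only [boundaryForm, c1, c2, f1, map_mul, map_neg, map_add, map_inv₀, conj_phase, inv_inv]
    ring
  · have c3 : u n 1 1 = (phase a)⁻¹ * u (n + 1) 0 0 := by
      rw [hk.cont_three n]
      field_simp
    have c4 : u n 2 0 = u (n + 1) 0 0 := by rw [← hk.cont_four n, hk.cont_three n]
    have f2 : u' (n + 1) 0 0 = phase a * u' n 1 1 - u' n 2 0 := by
      linear_combination hk.flux_two n
    simp only [boundaryForm, c3, c4, f2, map_mul, map_sub, map_inv₀, conj_phase, inv_inv]
    ring

theorem LocalSolution.start_ne_zero (S : LocalSolution q N k a lam) :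
    ∃ t ∈ Icc (0 : ℝ) 1, S.valueZero 0 * theta q lam t + S.slopeZero 0 * phi q lam t ≠ 0 := by
  by_contra! h
  have hs := IsSolution.fundamental (q := q) (lam := lam) (S.valueZero 0) (S.slopeZero 0)
  have he := (hs.eqOn hasSecondDeriv_zero (by
    filter_upwards [ae_restrict_mem measurableSet_Icc] with t ht using h t ht)).2 zero_mem_unit
  have h0 := h 0 zero_mem_unit
  simp only [theta_zero, phi_zero, theta'_zero, phi'_zero, mul_one, mul_zero, add_zero,
    zero_add] at h0 he
  exact S.ne_zero.elim (fun h => h h0) fun h => h he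

theorem ofReal_re_eq_of_mul_eq_zero {I : ℝ} (hI : 0 < I)
    (h : (lam - (starRingEnd ℂ) lam) * (I : ℂ) = 0) : ((lam.re : ℝ) : ℂ) = lam := by
  have h1 : lam - (starRingEnd ℂ) lam = 0 :=
    (mul_eq_zero.1 h).resolve_right (by exact_mod_cast hI.ne')
  exact Complex.conj_eq_iff_re.1 (sub_eq_zero.1 h1).symm

/-- Energies with localised solutions are real. -/
theorem LocalSolution.real (S : LocalSolution q N k a lam)
    (hm : phase a * sPow N k = -(phase a)⁻¹) : ((lam.re : ℝ) : ℂ) = lam := by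
  -- For `x = δ₀` the function lives on the cells `-1` and `0`. Green's identity is summed over
  -- their six edges; the inner vertices cancel, and nothing leaves through the starts of edges
  -- `(-1,0)` and `(1,0)`.
  have hk := S.kirchhoff (Pi.single 0 1)
  set u := fun (n : ℤ) (j : Fin 3) (t : ℝ) =>
    ((Pi.single 0 1 : ℤ → ℂ) n * S.valueZero j + (Pi.single 0 1 : ℤ → ℂ) (n + 1) * S.valueNeg j)
        * theta q lam t
      + ((Pi.single 0 1 : ℤ → ℂ) n * S.slopeZero j
        + (Pi.single 0 1 : ℤ → ℂ) (n + 1) * S.slopeNeg j) * phi q lam t with hu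
  set u' := fun (n : ℤ) (j : Fin 3) (t : ℝ) =>
    ((Pi.single 0 1 : ℤ → ℂ) n * S.valueZero j + (Pi.single 0 1 : ℤ → ℂ) (n + 1) * S.valueNeg j)
        * theta' q lam t
      + ((Pi.single 0 1 : ℤ → ℂ) n * S.slopeZero j
        + (Pi.single 0 1 : ℤ → ℂ) (n + 1) * S.slopeNeg j) * phi' q lam t with hu'
  have hs : ∀ n j, IsSolution q lam (u n j) (u' n j) := fun n j => .fundamental _ _
  have hG : ∀ n j, boundaryForm (u n j) (u' n j) 1 - boundaryForm (u n j) (u' n j) 0 =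
      (lam - (starRingEnd ℂ) lam) * ((∫ x in (0 : ℝ)..1, ‖u n j x‖ ^ 2 : ℝ) : ℂ) :=
    fun n j => (hs n j).conj_wronskian
  have hnn : ∀ n j, 0 ≤ ∫ x in (0 : ℝ)..1, ‖u n j x‖ ^ 2 := fun n j =>
    intervalIntegral.integral_nonneg zero_le_one fun _ _ => by positivity
  obtain ⟨t, ht, hne⟩ := S.start_ne_zero
  have hpos : 0 < ∫ x in (0 : ℝ)..1, ‖u 0 0 x‖ ^ 2 :=
    integral_norm_sq_pos (hs 0 0).continuousOn ht (by simpa [hu] using hne)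
  have z1 : boundaryForm (u 1 0) (u' 1 0) 0 = 0 := by simp [boundaryForm, hu, hu']
  have z2 : boundaryForm (u (-1) 0) (u' (-1) 0) 0 = 0 := by
    simp [boundaryForm, hu, hu', S.valueNeg_zero, S.slopeNeg_zero]
  obtain ⟨v1, w1⟩ := hk.boundaryForm_eq_zero hm 0
  obtain ⟨v2, w2⟩ := hk.boundaryForm_eq_zero hm (-1)
  rw [zero_add, z1] at w1
  rw [neg_add_cancel] at w2
  refine ofReal_re_eq_of_mul_eq_zero (I := (∫ x in (0 : ℝ)..1, ‖u 0 0 x‖ ^ 2)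
    + (∫ x in (0 : ℝ)..1, ‖u 0 1 x‖ ^ 2) + (∫ x in (0 : ℝ)..1, ‖u 0 2 x‖ ^ 2)
    + (∫ x in (0 : ℝ)..1, ‖u (-1) 0 x‖ ^ 2) + (∫ x in (0 : ℝ)..1, ‖u (-1) 1 x‖ ^ 2)
    + ∫ x in (0 : ℝ)..1, ‖u (-1) 2 x‖ ^ 2)
    (by linarith [hnn 0 1, hnn 0 2, hnn (-1) 0, hnn (-1) 1, hnn (-1) 2]) ?_
  push_cast
  linear_combination v1 + v2 - w1 - w2 - z2 - hG 0 0 - hG 0 1 - hG 0 2 - hG (-1) 0 - hG (-1) 1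
    - hG (-1) 2

theorem mem_dirichletSpectrum_iff : lam ∈ dirichletSpectrum q ↔ phi q lam 1 = 0 := by
  constructor
  · rintro ⟨y, y', h, h0, h1, t, ht, hne⟩
    rw [h.eq_comb one_mem_unit, h0, zero_mul, zero_add] at h1
    refine (mul_eq_zero.1 h1).resolve_left fun h' => hne ?_
    rw [h.eq_comb ht, h0, h']
    simp
  · intro h
    refine ⟨_, _, phi_isSolution q lam, phi_zero q lam, h, ?_⟩
    by_contra! hz
    have he := ((phi_isSolution q lam).eqOn hasSecondDeriv_zero (by
      filter_upwards [ae_restrict_mem measurableSet_Icc] with t ht using hz t ht)).2 zero_mem_unit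
    simp at he

theorem dirichlet_real (h : phi q lam 1 = 0) : ((lam.re : ℝ) : ℂ) = lam := by
  obtain ⟨y, y', hs, h0, h1, t, ht, hne⟩ := mem_dirichletSpectrum_iff.2 h
  refine ofReal_re_eq_of_mul_eq_zero (integral_norm_sq_pos hs.continuousOn ht hne) ?_
  rw [← hs.conj_wronskian, h0, h1]
  simp

theorem sq_add_one_ne_zero_of_conj {z : ℂ} (h : (starRingEnd ℂ) z = z) : z ^ 2 + 1 ≠ 0 := by
  rw [← Complex.conj_eq_iff_re.1 h]
  have : (0 : ℝ) < z.re ^ 2 + 1 := by positivity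
  exact_mod_cast this.ne'

/-- Dirichlet eigenvalues are real, so `φ'(1)` is real. This makes the denominators of
`dirichletSolution` nonzero. -/
theorem phi'_sq_add_one_ne_zero (h : phi q lam 1 = 0) : phi' q lam 1 ^ 2 + 1 ≠ 0 := by
  rw [← dirichlet_real h]
  exact sq_add_one_ne_zero_of_conj (conj_phi' q _ one_mem_unit)

/-- At the real energies with `F = -1` the constants of the localised eigenfunction do not
vanish. -/
theorem constants_ne_zero {lam : ℝ} (hF : constOne q lam * constThree q lam = 1) :
    phi q lam 1 ≠ 0 ∧ constOne q lam ≠ 0 ∧ constTwo q lam ≠ 0 := by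
  have hW := wronskian_theta_phi q lam one_mem_unit
  have hx := sq_add_one_ne_zero_of_conj (conj_phi' q lam one_mem_unit)
  -- If `φ(1) = 0`, then `F = -1` forces `Δ = 0`, so `ϑ(1) = -φ'(1)`, and the Wronskian gives
  -- `φ'(1)² = -1` for a real number.
  have hφ : phi q lam 1 ≠ 0 := by
    intro h
    rw [h] at hW
    have hF' := (bigF_eq_neg_one_iff q lam).2 hF
    rw [bigF, h, lyapunov] at hF'
    have : (phi' q lam 1 + theta q lam 1) ^ 2 = 0 := by linear_combination 2 * hF'
    have := pow_eq_zero_iff (two_ne_zero) |>.1 this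
    refine hx ?_
    linear_combination phi' q lam 1 * this - hW
  have hC : constOne q lam ≠ 0 := fun h => by simp [h] at hF
  refine ⟨hφ, hC, fun h => ?_⟩
  have h2 := phi_mul_constTwo hφ
  rw [h, mul_zero] at h2
  -- If `C₂ = 0`, then `ϑ(1) C₁ = 1 = C₁C₃`, hence `Δ = 0` and `C₁ = φ'(1) = -ϑ(1)`: again `φ'(1)² =
  -- -1`.
  have h3 : constOne q lam * (phi' q lam 1 + theta q lam 1) = 0 := by
    have e : constThree q lam = theta q lam 1 + (phi' q lam 1 + theta q lam 1) := by
      rw [constThree, lyapunov]; ring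
    rw [e] at hF
    linear_combination hF - h2
  have h4 := (mul_eq_zero.1 h3).resolve_left hC
  rw [constOne, lyapunov] at h2
  refine hx ?_
  linear_combination (theta q lam 1 + phi' q lam 1) * h4 - h2

end Symmetry

/-! ### Eigenspaces and infinite multiplicity -/

section Eigenspace

variable {q : Potential} {lam : ℂ} {N : ℕ} {k : ℤ} {a : ℝ}

theorem tubeOperator_eq_iff {f g : GraphL2} :
    (∃ h : f ∈ (tubeOperator q N k a).domain, tubeOperator q N k a ⟨f, h⟩ = g) ↔
      IsValue q N k a f g := by
  constructor
  · rintro ⟨h, rfl⟩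
    exact tubeOperator_spec q N k a ⟨f, h⟩
  · intro h
    have hd : f ∈ (tubeOperator q N k a).domain := by
      obtain ⟨w, u, u', h1, h2, -⟩ := h
      exact ⟨w, u, u', h1, h2⟩
    exact ⟨hd, (tubeOperator_spec q N k a ⟨f, hd⟩).unique h⟩

theorem mem_opEigenspace_iff {f : GraphL2} :
    f ∈ opEigenspace (tubeOperator q N k a) lam ↔ IsValue q N k a f (lam • f) := by
  rw [← tubeOperator_eq_iff, opEigenspace, Submodule.mem_map]
  constructor
  · rintro ⟨y, hy, rfl⟩
    exact ⟨y.2, sub_eq_zero.1 hy⟩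
  · rintro ⟨h, he⟩
    exact ⟨⟨f, h⟩, sub_eq_zero.2 he, rfl⟩

/-- Any representative of an eigenfunction consists of solutions. -/
theorem IsRep.isSolution {f w : GraphL2} {u u' : ℤ → Fin 3 → ℝ → ℂ}
    (hf : f ∈ opEigenspace (tubeOperator q N k a) lam) (h : IsRep f w u u') :
    Kirchhoff N k a u u' ∧ ∀ n j, IsSolution q lam (u n j) (u' n j) := by
  obtain ⟨z, v, v', hr, hk, hv⟩ := mem_opEigenspace_iff.1 hf
  have huv : ∀ n j, ∀ᵐ t ∂edgeMeasure, u n j t = v n j t := fun n j => by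
    filter_upwards [(h n j).1, (hr n j).1] with t h1 h2
    rw [← h1, h2]
  have e := fun n j => (h n j).2.eqOn (hr n j).2 (huv n j)
  refine ⟨⟨fun n => ?_, fun n => ?_, fun n => ?_, fun n => ?_, fun n => ?_, fun n => ?_⟩,
    fun n j => ?_⟩
  · rw [(e _ _).1 one_mem_unit, (e _ _).1 zero_mem_unit, hk.cont_one]
  · rw [(e _ _).1 zero_mem_unit, (e _ _).1 one_mem_unit, hk.cont_two]
  · rw [(e _ _).1 zero_mem_unit, (e _ _).1 one_mem_unit, hk.cont_three]
  · rw [(e _ _).1 zero_mem_unit, (e _ _).1 one_mem_unit, hk.cont_four]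
  · rw [(e _ _).2 one_mem_unit, (e _ _).2 zero_mem_unit, (e _ _).2 one_mem_unit, hk.flux_one]
  · rw [(e _ _).2 zero_mem_unit, (e _ _).2 one_mem_unit, (e _ _).2 zero_mem_unit, hk.flux_two]
  · refine (h n j).2.congr_ae ?_
    filter_upwards [(h n j).2.ae_unique (hr n j).2 (huv n j), hv n j, (h n j).1,
      Lp.coeFn_smul lam (f (n, j))] with t h1 h2 h3 h4
    rw [lp.coeFn_smul, Pi.smul_apply, h4, Pi.smul_apply, smul_eq_mul] at h2
    rw [h1, ← h3]
    linear_combination h2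

theorem exists_edgeL2_of_isSolution {y y' : ℝ → ℂ} (h : IsSolution q lam y y') :
    ∃ f w : EdgeL2, (∀ᵐ t ∂edgeMeasure, f t = y t) ∧
      ∀ᵐ t ∂edgeMeasure, w t = ((q t : ℂ) - lam) * y t := by
  obtain ⟨K, hK⟩ := isCompact_Icc.exists_bound_of_continuousOn h.continuousOn
  obtain ⟨f, hf, -⟩ := exists_edgeL2 h.continuousOn hK
  obtain ⟨w, hw, -⟩ := exists_edgeL2_potential_mul q lam h.continuousOn hK
  exact ⟨f, w, hf, hw⟩

/-- The eigenfunctions generated by a localised solution. -/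
theorem LocalSolution.exists_synthesis (S : LocalSolution q N k a lam) :
    ∃ P Q : Fin 3 → EdgeL2,
      (∀ j, ∀ᵐ t ∂edgeMeasure, P j t = S.valueZero j * theta q lam t + S.slopeZero j * phi q lam t)
      ∧ (∀ j, ∀ᵐ t ∂edgeMeasure, Q j t = S.valueNeg j * theta q lam t + S.slopeNeg j * phi q lam t)
      ∧ P 0 ≠ 0 ∧ Q 0 = 0 ∧
      ∀ x, cellSynthesis P Q x ∈ opEigenspace (tubeOperator q N k a) lam := by
  -- `P` and `Q` are the profiles on the cells `0` and `-1`; `P2` and `Q2` are their second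
  -- derivatives, whose synthesis supplies the second derivative of the eigenfunction.
  choose P P2 hP hP2 using fun j => exists_edgeL2_of_isSolution
    (IsSolution.fundamental (q := q) (lam := lam) (S.valueZero j) (S.slopeZero j))
  choose Q Q2 hQ hQ2 using fun j => exists_edgeL2_of_isSolution
    (IsSolution.fundamental (q := q) (lam := lam) (S.valueNeg j) (S.slopeNeg j))
  refine ⟨P, Q, hP, hQ, fun h => ?_, ?_, fun x => ?_⟩
  · obtain ⟨t, ht, hne⟩ := S.start_ne_zero
    refine hne (Measure.eqOn_Icc_of_ae_eq volume zero_ne_one ?_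
      (IsSolution.fundamental (q := q) (lam := lam) _ _).continuousOn
      (continuousOn_const (c := (0 : ℂ))) ht)
    filter_upwards [hP 0, Lp.coeFn_zero ℂ 2 edgeMeasure] with t h1 h2
    rw [← h1, h, h2, Pi.zero_apply]
  · refine Lp.ext ?_
    filter_upwards [hQ 0, Lp.coeFn_zero ℂ 2 edgeMeasure] with t h1 h2
    rw [h1, h2, S.valueNeg_zero, S.slopeNeg_zero]
    simp
  · have hc : ∀ (A B : Fin 3 → EdgeL2) n j, ∀ᵐ t ∂edgeMeasure,
        cellSynthesis A B x (n, j) t = x n * A j t + x (n + 1) * B j t := by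
      intro A B n j
      rw [cellSynthesis_apply]
      filter_upwards [Lp.coeFn_add (x n • A j) (x (n + 1) • B j), Lp.coeFn_smul (x n) (A j),
        Lp.coeFn_smul (x (n + 1)) (B j)] with t h1 h2 h3
      rw [h1, Pi.add_apply, h2, h3]
      rfl
    refine mem_opEigenspace_iff.2 ⟨cellSynthesis P2 Q2 x, _, _, fun n j => ⟨?_, ?_⟩,
      S.kirchhoff x, fun n j => ?_⟩
    · filter_upwards [hc P Q n j, hP j, hQ j] with t h1 h2 h3
      rw [h1, h2, h3]
      ring
    · refine HasSecondDeriv.congr_ae (IsSolution.fundamental (q := q) (lam := lam) _ _) ?_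
      filter_upwards [hc P2 Q2 n j, hP2 j, hQ2 j] with t h1 h2 h3
      rw [h1, h2, h3]
      ring
    · filter_upwards [hc P Q n j, hP j, hQ j, hc P2 Q2 n j, hP2 j, hQ2 j,
        Lp.coeFn_smul lam (cellSynthesis P Q x (n, j))] with t h1 h2 h3 h4 h5 h6 h7
      rw [lp.coeFn_smul, Pi.smul_apply, h7, Pi.smul_apply, h1, h2, h3, h4, h5, h6, smul_eq_mul]
      ring

theorem cellSynthesis_injective {P Q : Fin 3 → EdgeL2} (hP : P 0 ≠ 0) (hQ : Q 0 = 0) :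
    Function.Injective (cellSynthesis P Q) := by
  refine (injective_iff_map_eq_zero _).2 fun x hx => ?_
  have := norm_le_norm_cellSynthesis P Q hQ x
  rw [hx, norm_zero] at this
  have hp := norm_pos_iff.2 hP
  exact norm_le_zero_iff.1 (nonpos_of_mul_nonpos_right this hp)

/-- The synthesis map embeds the infinite-dimensional space `ℓ²(ℤ)` in the eigenspace. -/
theorem LocalSolution.mem_infiniteEigenvalues (S : LocalSolution q N k a lam) :
    lam ∈ infiniteEigenvalues (tubeOperator q N k a) := by
  obtain ⟨P, Q, -, -, hP, hQ, hmem⟩ := S.exists_synthesis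
  have hfin : ¬ FiniteDimensional ℂ (opEigenspace (tubeOperator q N k a) lam) := by
    intro h
    refine not_finiteDimensional_lp_int (FiniteDimensional.of_injective
      ((cellSynthesis P Q : lp (fun _ : ℤ => ℂ) 2 →ₗ[ℂ] GraphL2).codRestrict
        (opEigenspace (tubeOperator q N k a) lam) hmem) fun x y hxy => ?_)
    exact cellSynthesis_injective hP hQ (congrArg Subtype.val hxy)
  refine ⟨fun h => hfin ?_, hfin⟩
  rw [h]
  infer_instance

end Eigenspace

/-! ### Criteria for membership in the spectrum -/

section AbstractSpectrum

variable {E : Type*} [NormedAddCommGroup E] [InnerProductSpace ℂ E]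

theorem infiniteEigenvalues_subset_opSpectrum (T : E →ₗ.[ℂ] E) :
    infiniteEigenvalues T ⊆ opSpectrum T := by
  rintro lam ⟨h, -⟩ ⟨R, -, hR⟩
  obtain ⟨f, hf, hne⟩ := (Submodule.ne_bot_iff _).1 h
  obtain ⟨y, hy, rfl⟩ := Submodule.mem_map.1 hf
  refine hne ?_
  have := hR y
  have h0 : T y - lam • (y : E) = 0 := hy
  rw [h0, map_zero] at this
  exact this.symm

/-- If `T - lam` is injective and has a bounded right inverse, then `lam` is in the resolvent
set. -/
theorem notMem_opSpectrum {T : E →ₗ.[ℂ] E} {lam : ℂ} (h0 : opEigenspace T lam = ⊥) (C : ℝ)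
    (hC : ∀ g : E, ∃ y : T.domain, T y - lam • (y : E) = g ∧ ‖(y : E)‖ ≤ C * ‖g‖) :
    lam ∉ opSpectrum T := by
  have hinj : ∀ y z : T.domain, T y - lam • (y : E) = T z - lam • (z : E) → y = z := by
    intro y z h
    have : ((y - z : T.domain) : E) ∈ opEigenspace T lam := by
      refine Submodule.mem_map.2 ⟨y - z, ?_, rfl⟩
      change T (y - z) - lam • ((y - z : T.domain) : E) = 0
      rw [LinearPMap.map_sub, Submodule.coe_sub, smul_sub, sub_sub_sub_comm, h, sub_self]
    rw [h0, Submodule.mem_bot, Submodule.coe_sub, sub_eq_zero] at this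
    exact Subtype.ext this
  -- The preimages are chosen without regard to linearity; injectivity makes the choice unique and
  -- therefore linear.
  choose Y hY hYC using hC
  refine fun hs => hs ⟨LinearMap.mkContinuous
    { toFun := fun g => (Y g : E)
      map_add' := fun g h => by
        rw [← Submodule.coe_add]
        refine congrArg Subtype.val (hinj _ _ ?_)
        rw [hY, LinearPMap.map_add, Submodule.coe_add, smul_add, add_sub_add_comm, hY, hY]
      map_smul' := fun c g => by
        rw [RingHom.id_apply, ← Submodule.coe_smul]
        refine congrArg Subtype.val (hinj _ _ ?_)
        rw [hY, LinearPMap.map_smul, Submodule.coe_smul, smul_comm, ← smul_sub, hY] }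
    C hYC, fun g => ⟨(Y g).2, hY g⟩, fun y => ?_⟩
  exact congrArg Subtype.val (hinj _ _ (hY _))

end AbstractSpectrum

/-! ### The resolvent away from the singular energies, and the spectrum -/

section Resolvent

open Asymptotics

variable {q : Potential} {lam : ℂ} {N : ℕ} {k : ℤ} {a : ℝ}

/-- Away from the singular energies the equation `(H - lam) f = g` has a solution that is bounded
by `g`. -/
theorem exists_bounded_solution (hm : phase a * sPow N k = -(phase a)⁻¹) (hφ : phi q lam 1 ≠ 0)
    (hF : constOne q lam * constThree q lam ≠ 1) :
    ∃ C : ℝ, ∀ g : GraphL2, ∃ f : GraphL2, IsValue q N k a f (g + lam • f) ∧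
      ‖f‖ ≤ C * ‖g‖ := by
  obtain ⟨C, hC, hpart⟩ := exists_particular_solution q lam
  choose V V' hV hV0 hV0' hVb hVb' using hpart
  have hdet : 1 - constOne q lam * constThree q lam ≠ 0 := sub_ne_zero.2 hF.symm
  let v : GraphL2 → ℤ → Fin 3 → ℝ → ℂ := fun g n j => V (g (n, j))
  let v' : GraphL2 → ℤ → Fin 3 → ℝ → ℂ := fun g n j => V' (g (n, j))
  let r : GraphL2 → ℤ → ℂ := fun g n =>
    phi q lam 1 * (v' g n 0 1 - (phase a)⁻¹ * v' g n 2 1)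
      - phi' q lam 1 * (v g n 0 1 - (phase a)⁻¹ * v g n 2 1) + v g n 1 1
  let s : GraphL2 → ℤ → ℂ := fun g n =>
    v g n 0 1 + phase a * (phi q lam 1 * v' g (n - 1) 1 1 - phi' q lam 1 * v g (n - 1) 1 1)
      + v g (n - 1) 2 1
  -- Elimination of `y (n - 1)` from the two recurrences with sources `r` and `s`.
  let x : GraphL2 → ℤ → ℂ := fun g n =>
    (1 - constOne q lam * constThree q lam)⁻¹ * (constThree q lam * r g n + s g n)
  let y : GraphL2 → ℤ → ℂ := fun g n => constOne q lam * x g (n + 1) + r g (n + 1)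
  have hy : ∀ g n, y g (n - 1) = constOne q lam * x g n + r g n := fun g n => by
    simp only [y, sub_add_cancel]
  have hx : ∀ g n, x g n = constThree q lam * y g (n - 1) + s g n := fun g n => by
    rw [hy]
    simp only [x]
    field_simp
    ring
  let T : GraphL2 × ℤ → ℝ := fun p => cellNorm p.1 (p.2 - 1) + cellNorm p.1 p.2
    + cellNorm p.1 (p.2 + 1)
  have hT0 : ∀ p, 0 ≤ T p := fun p => add_nonneg (add_nonneg (cellNorm_nonneg _ _)
    (cellNorm_nonneg _ _)) (cellNorm_nonneg _ _)
  have hcell : ∀ (g : GraphL2) (n : ℤ) (m : ℤ) (j : Fin 3), m = n - 1 ∨ m = n ∨ m = n + 1 →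
      ‖g (m, j)‖ ≤ T (g, n) := by
    intro g n m j hmn
    have h1 := cellNorm_nonneg g (n - 1)
    have h2 := cellNorm_nonneg g n
    have h3 := cellNorm_nonneg g (n + 1)
    refine (norm_le_cellNorm g m j).trans ?_
    simp only [T]
    rcases hmn with rfl | rfl | rfl <;> linarith
  -- Big-O along `⊤` on pairs `(g, n)` means one constant for all `g` and all `n`. The shifts `σ`
  -- cover the neighbouring cells that enter `r`, `s` and `y`.
  have hv : ∀ (σ : ℤ → ℤ), (∀ n, σ n = n - 1 ∨ σ n = n ∨ σ n = n + 1) → ∀ j,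
      (fun p : GraphL2 × ℤ => v p.1 (σ p.2) j 1) =O[⊤] T ∧
      (fun p : GraphL2 × ℤ => v' p.1 (σ p.2) j 1) =O[⊤] T := by
    intro σ hσ j
    have hle : ∀ p : GraphL2 × ℤ, C * ‖p.1 (σ p.2, j)‖ ≤ C * ‖T p‖ := fun p => by
      rw [Real.norm_of_nonneg (hT0 p)]
      exact mul_le_mul_of_nonneg_left (hcell p.1 p.2 (σ p.2) j (hσ p.2)) hC
    exact ⟨.of_bound C (.of_forall fun p => (hVb _ 1 one_mem_unit).trans (hle p)),
      .of_bound C (.of_forall fun p => (hVb' _).trans (hle p))⟩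
  have v0 := hv (fun n => n) fun n => .inr (.inl rfl)
  have vp := hv (fun n => n + 1) fun n => .inr (.inr rfl)
  have vm := hv (fun n => n - 1) fun n => .inl rfl
  have hr0 : (fun p : GraphL2 × ℤ => r p.1 p.2) =O[⊤] T :=
    ((((v0 0).2.sub ((v0 2).2.const_mul_left _)).const_mul_left _).sub
      (((v0 0).1.sub ((v0 2).1.const_mul_left _)).const_mul_left _)).add (v0 1).1
  have hrp : (fun p : GraphL2 × ℤ => r p.1 (p.2 + 1)) =O[⊤] T :=
    ((((vp 0).2.sub ((vp 2).2.const_mul_left _)).const_mul_left _).sub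
      (((vp 0).1.sub ((vp 2).1.const_mul_left _)).const_mul_left _)).add (vp 1).1
  have hs0 : (fun p : GraphL2 × ℤ => s p.1 p.2) =O[⊤] T :=
    ((v0 0).1.add ((((vm 1).2.const_mul_left _).sub ((vm 1).1.const_mul_left _)).const_mul_left
      _)).add (vm 2).1
  have hsp : (fun p : GraphL2 × ℤ => s p.1 (p.2 + 1)) =O[⊤] T := by
    simp only [s, add_sub_cancel_right]
    exact ((vp 0).1.add ((((v0 1).2.const_mul_left _).sub
      ((v0 1).1.const_mul_left _)).const_mul_left _)).add (v0 2).1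
  have hx0 : (fun p : GraphL2 × ℤ => x p.1 p.2) =O[⊤] T :=
    ((hr0.const_mul_left _).add hs0).const_mul_left _
  have hxp : (fun p : GraphL2 × ℤ => x p.1 (p.2 + 1)) =O[⊤] T :=
    ((hrp.const_mul_left _).add hsp).const_mul_left _
  have hy0 : (fun p : GraphL2 × ℤ => y p.1 p.2) =O[⊤] T := (hxp.const_mul_left _).add hrp
  have hym : (fun p : GraphL2 × ℤ => y p.1 (p.2 - 1)) =O[⊤] T := by
    simp only [hy]
    exact (hx0.const_mul_left _).add hr0
  have hstart : ∀ j, (fun p : GraphL2 × ℤ => startValue (x p.1) (y p.1) p.2 j) =O[⊤] T := by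
    intro j
    fin_cases j
    exacts [hym, hx0, hy0]
  have hend : ∀ j, (fun p : GraphL2 × ℤ => endValue a (x p.1) (y p.1) p.2 j) =O[⊤] T := by
    intro j
    fin_cases j
    exacts [hx0, hy0.const_mul_left _, hx0.const_mul_left _]
  have hslope : ∀ j,
      (fun p : GraphL2 × ℤ => startSlope q lam a (v p.1) (x p.1) (y p.1) p.2 j) =O[⊤] T := by
    intro j
    simp only [startSlope, div_eq_inv_mul]
    exact (((hend j).sub (v0 j).1).sub ((hstart j).const_mul_left _)).const_mul_left _
  choose A hA0 hA using fun j => (hstart j).exists_nonneg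
  choose B hB0 hB using fun j => (hslope j).exists_nonneg
  simp only [isBigOWith_top] at hA hB
  obtain ⟨M1, h1⟩ := isCompact_Icc.exists_bound_of_continuousOn (theta_isSolution q lam).continuousOn
  obtain ⟨M2, h2⟩ := isCompact_Icc.exists_bound_of_continuousOn (phi_isSolution q lam).continuousOn
  have p1 := (norm_nonneg _).trans (h1 0 zero_mem_unit)
  have p2 := (norm_nonneg _).trans (h2 0 zero_mem_unit)
  let K : ℝ := ∑ j, (A j * M1 + B j * M2 + C)
  have hKj : ∀ j, A j * M1 + B j * M2 + C ≤ K := fun j =>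
    Finset.single_le_sum (f := fun j => A j * M1 + B j * M2 + C)
      (fun i _ => by have := hA0 i; have := hB0 i; positivity) (Finset.mem_univ j)
  have hK0 : 0 ≤ K := Finset.sum_nonneg
    fun i _ => by have := hA0 i; have := hB0 i; positivity
  let u : GraphL2 → ℤ → Fin 3 → ℝ → ℂ := fun g n j t => startValue (x g) (y g) n j * theta q lam t
    + startSlope q lam a (v g) (x g) (y g) n j * phi q lam t + v g n j t
  let u' : GraphL2 → ℤ → Fin 3 → ℝ → ℂ := fun g n j t =>
    startValue (x g) (y g) n j * theta' q lam t
      + startSlope q lam a (v g) (x g) (y g) n j * phi' q lam t + v' g n j t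
  have hu2 : ∀ g n j, HasSecondDeriv (u g n j) (u' g n j)
      fun t => ((q t : ℂ) - lam) * u g n j t - g (n, j) t := fun g n j =>
    ((IsSolution.fundamental _ _).add (hV (g (n, j)))).congr_ae (.of_forall fun t => by
      simp only [u, v]; ring)
  have hub : ∀ g n j, ∀ t ∈ Icc (0 : ℝ) 1, ‖u g n j t‖ ≤ K * T (g, n) := by
    intro g n j t ht
    have b1 := hA j (g, n)
    have b2 := hB j (g, n)
    have b3 : ‖v g n j t‖ ≤ C * T (g, n) := (hVb _ t ht).trans
      (mul_le_mul_of_nonneg_left (hcell g n n j (.inr (.inl rfl))) hC)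
    have hTn := hT0 (g, n)
    rw [Real.norm_of_nonneg hTn] at b1 b2
    refine (norm_add_le _ _).trans ((add_le_add (norm_add_le _ _) le_rfl).trans ?_)
    rw [norm_mul, norm_mul]
    have c1 := mul_le_mul b1 (h1 t ht) (norm_nonneg _) (mul_nonneg (hA0 j) hTn)
    have c2 := mul_le_mul b2 (h2 t ht) (norm_nonneg _) (mul_nonneg (hB0 j) hTn)
    have c3 := mul_le_mul_of_nonneg_right (hKj j) hTn
    simp only at c1 c2
    linarith
  -- The square of the norm is at most `27 K² · 3 ‖g‖² = (9 K ‖g‖)²`.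
  refine ⟨9 * K, fun g => ?_⟩
  have hk : Kirchhoff N k a (u g) (u' g) := kirchhoff_of_vertex_values hm hφ
    (fun n j => hV0 _) (fun n j => hV0' _) (hy g) (hx g)
  obtain ⟨hS, hSle⟩ := summable_cellNorm_sq g
  choose f hf hfb using fun α : ℤ × Fin 3 =>
    exists_edgeL2 (hu2 g α.1 α.2).continuousOn (hub g α.1 α.2)
  choose w hw hwb using fun α : ℤ × Fin 3 =>
    exists_edgeL2_potential_mul q lam (hu2 g α.1 α.2).continuousOn (hub g α.1 α.2)
  obtain ⟨hfm, hfn⟩ := memlp_of_le_neighbours (f := f) hS fun n j => hfb (n, j)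
  obtain ⟨hwm, -⟩ := memlp_of_le_neighbours (f := w) (C := K * ‖shiftedPotential q lam‖) hS
    fun n j => (hwb (n, j)).trans (le_of_eq (by simp only [T]; ring))
  have hgw : ∀ n j, ∀ᵐ t ∂edgeMeasure, ((⟨w, hwm⟩ : GraphL2) - g) (n, j) t =
      ((q t : ℂ) - lam) * u g n j t - g (n, j) t := by
    intro n j
    filter_upwards [Lp.coeFn_sub (w (n, j)) (g (n, j)), hw (n, j)] with t h3 h4
    rw [lp.coeFn_sub, Pi.sub_apply]
    exact h3.trans (by rw [Pi.sub_apply, h4])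
  -- The equation prescribes `f'' = (q - lam) f - g`, and `w` is the part `(q - lam) f`.
  refine ⟨⟨f, hfm⟩, ⟨⟨w, hwm⟩ - g, u g, u' g, fun n j => ⟨hf (n, j), (hu2 g n j).congr_ae ?_⟩, hk,
    fun n j => ?_⟩, ?_⟩
  · filter_upwards [hgw n j] with t h3
    exact h3.symm
  · filter_upwards [hgw n j, hf (n, j), Lp.coeFn_add (g (n, j)) (lam • f (n, j)),
      Lp.coeFn_smul lam (f (n, j))] with t h3 h4 h5 h6
    rw [h3, lp.coeFn_add, Pi.add_apply, lp.coeFn_smul, Pi.smul_apply]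
    refine h5.trans ?_
    rw [Pi.add_apply, h6, Pi.smul_apply, smul_eq_mul, h4]
    ring
  · refine abs_le_of_sq_le_sq' ?_ (by positivity) |>.2
    rw [← (lp_two_norm_sq _).2]
    refine hfn.trans ((mul_le_mul_of_nonneg_left hSle (by positivity)).trans (le_of_eq ?_))
    ring

/-- The nonzero determinant kills all vertex values, and a solution with zero values at both ends
vanishes because `φ(1) ≠ 0`. -/
theorem opEigenspace_eq_bot (hm : phase a * sPow N k = -(phase a)⁻¹) (hφ : phi q lam 1 ≠ 0)
    (hF : constOne q lam * constThree q lam ≠ 1) :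
    opEigenspace (tubeOperator q N k a) lam = ⊥ := by
  refine (Submodule.eq_bot_iff _).2 fun f hf => ?_
  obtain ⟨w, u, u', hr, -⟩ := mem_opEigenspace_iff.1 hf
  obtain ⟨hk, hs⟩ := hr.isSolution hf
  have hrel := hk.vertex_relations hm hs
  have h1 : ∀ n, u n 1 0 = 0 := by
    intro n
    have h : (1 - constOne q lam * constThree q lam) * u n 1 0 = 0 := by
      linear_combination (hrel n).2 + constThree q lam * (hrel n).1
    exact (mul_eq_zero.1 h).resolve_left (sub_ne_zero.2 hF.symm)
  have h0 : ∀ n, u n 0 0 = 0 := fun n => by rw [(hrel n).1, h1, mul_zero]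
  have hstart : ∀ n j, u n j 0 = 0 := by
    intro n j
    fin_cases j
    exacts [h0 n, h1 n, by
      have := hk.cont_three n
      rw [hk.cont_four, h0] at this
      exact this.symm]
  have hend : ∀ n j, u n j 1 = 0 := by
    intro n j
    fin_cases j
    · exact (hk.cont_one n).trans (h1 n)
    · have := hk.cont_three n
      rw [h0] at this
      exact (mul_eq_zero.1 this.symm).resolve_left (phase_ne_zero a)
    · have := hk.cont_two n
      rw [h1, hm] at this
      exact (mul_eq_zero.1 this.symm).resolve_left (neg_ne_zero.2 (inv_ne_zero (phase_ne_zero a)))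
  ext ⟨n, j⟩ : 2
  refine Lp.ext ?_
  filter_upwards [(hr n j).1, Lp.coeFn_zero ℂ 2 edgeMeasure, ae_restrict_mem measurableSet_Icc]
    with t h1 h2 ht
  have hd : u' n j 0 = 0 := by
    have := (hs n j).phi_mul_deriv_zero
    rw [hend, hstart, mul_zero, sub_zero] at this
    exact (mul_eq_zero.1 this).resolve_left hφ
  rw [h1, (hs n j).eq_comb ht, hstart, hd, lp.coeFn_zero, Pi.zero_apply, h2]
  simp

theorem opSpectrum_subset (hm : phase a * sPow N k = -(phase a)⁻¹) :
    opSpectrum (tubeOperator q N k a) ⊆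
      dirichletSpectrum q ∪ (fun lam : ℝ => (lam : ℂ)) '' singularEnergies q := by
  intro lam hlam
  by_contra hcon
  rw [mem_union, not_or, mem_dirichletSpectrum_iff] at hcon
  obtain ⟨hφ, hcon⟩ := hcon
  have hF : constOne q lam * constThree q lam ≠ 1 := by
    intro hF
    have hre := (antiperiodicSolution hm hφ hF).real hm
    refine hcon ⟨lam.re, ?_, hre⟩
    change bigF q ((lam.re : ℝ) : ℂ) = -1
    rw [hre]
    exact (bigF_eq_neg_one_iff q lam).2 hF
  obtain ⟨C, hC⟩ := exists_bounded_solution hm hφ hF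
  refine notMem_opSpectrum (opEigenspace_eq_bot hm hφ hF) C (fun g => ?_) hlam
  obtain ⟨f, hf, hb⟩ := hC g
  obtain ⟨hd, he⟩ := tubeOperator_eq_iff.2 hf
  exact ⟨⟨f, hd⟩, by rw [he, add_sub_cancel_right], hb⟩

theorem subset_infiniteEigenvalues (hm : phase a * sPow N k = -(phase a)⁻¹) :
    dirichletSpectrum q ∪ (fun lam : ℝ => (lam : ℂ)) '' singularEnergies q ⊆
      infiniteEigenvalues (tubeOperator q N k a) := by
  rintro lam (h | ⟨lam, h, rfl⟩)
  · have hφ := mem_dirichletSpectrum_iff.1 h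
    exact (dirichletSolution hm hφ (phi'_sq_add_one_ne_zero hφ)).mem_infiniteEigenvalues
  · have hF := (bigF_eq_neg_one_iff q lam).1 h
    exact (antiperiodicSolution hm (constants_ne_zero hF).1 hF).mem_infiniteEigenvalues

end Resolvent

/-! ### Expansion in localised eigenfunctions -/

section Expansion

variable {q : Potential} {lam : ℂ} {N : ℕ} {k : ℤ} {a : ℝ}

/-- An eigenfunction is determined by its values at the initial points of the edges `(n, 1)`. -/
theorem eigenfunction_representation (hm : phase a * sPow N k = -(phase a)⁻¹)
    (hφ : phi q lam 1 ≠ 0) (hF : constOne q lam * constThree q lam = 1)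
    {u u' : ℤ → Fin 3 → ℝ → ℂ} (hk : Kirchhoff N k a u u')
    (hs : ∀ n j, IsSolution q lam (u n j) (u' n j)) :
    let S := antiperiodicSolution hm hφ hF
    ∀ n j, u n j 0 = u n 1 0 * S.valueZero j + u (n + 1) 1 0 * S.valueNeg j ∧
      u' n j 0 = u n 1 0 * S.slopeZero j + u (n + 1) 1 0 * S.slopeNeg j := by
  intro S n j
  have hp := phase_ne_zero a
  have hrel := hk.vertex_relations hm hs
  -- Start and end values on cell `n` involve only `x n` and `x (n + 1)`, because `u n 2 0` is the
  -- start value of edge `(n + 1, 0)`. The slopes follow from them.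
  have hd : ∀ j, u' n j 0 = (u n j 1 - theta q lam 1 * u n j 0) / phi q lam 1 := fun j => by
    rw [← (hs n j).phi_mul_deriv_zero]
    field_simp
  have s0 := (hrel n).1
  have s2 : u n 2 0 = constOne q lam * u (n + 1) 1 0 := by
    rw [← (hrel (n + 1)).1, hk.cont_three, hk.cont_four]
  have e0 := hk.cont_one n
  have e1 : u n 1 1 = (phase a)⁻¹ * (constOne q lam * u (n + 1) 1 0) := by
    rw [← s2, ← hk.cont_four]
    field_simp
  have e2 : u n 2 1 = -phase a * u n 1 0 := by
    have := hk.cont_two n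
    rw [hm] at this
    rw [this]
    field_simp
  have hC2 : constTwo q lam = (1 - theta q lam 1 * constOne q lam) / phi q lam 1 := by
    rw [← phi_mul_constTwo hφ]; field_simp
  fin_cases j
  · simp only [S, antiperiodicSolution, Fin.zero_eta, Matrix.cons_val_zero]
    rw [hd, e0, s0, hC2]
    constructor <;> ring
  · simp only [S, antiperiodicSolution, Fin.mk_one, Matrix.cons_val_one, Matrix.cons_val_zero]
    rw [hd, e1]
    constructor <;> ring
  · simp only [S, antiperiodicSolution, Fin.reduceFinMk, Matrix.cons_val]
    rw [hd, e2, s2]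
    constructor <;> ring

/-- The expansion of the eigenfunctions with respect to the localised eigenfunctions. -/
theorem eigenspace_expansion (hm : phase a * sPow N k = -(phase a)⁻¹)
    (hφ : phi q lam 1 ≠ 0) (hC1 : constOne q lam ≠ 0) (hC2 : constTwo q lam ≠ 0)
    (hF : constOne q lam * constThree q lam = 1) :
    ∃ ψ : ℤ → GraphL2,
      (∀ n m j, ∀ᵐ t ∂edgeMeasure, ψ n (m, j) t = psiZero q a lam (m - n) j t) ∧
      (∀ n, ψ n ∈ opEigenspace (tubeOperator q N k a) lam) ∧
      ∃ Φ : opEigenspace (tubeOperator q N k a) lam ≃L[ℂ] lp (fun _ : ℤ => ℂ) 2,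
        ∀ f : opEigenspace (tubeOperator q N k a) lam,
          HasSum (fun n => Φ f n • ψ n) (f : GraphL2) ∧
          ∀ (w : GraphL2) (u u' : ℤ → Fin 3 → ℝ → ℂ), IsRep f w u u' →
            ∀ n, Φ f n = u n 1 0 ∧ Φ f n = u n 0 0 / constOne q lam ∧
              Φ f n = u' n 0 0 / constTwo q lam := by
  set S := antiperiodicSolution hm hφ hF with hS
  obtain ⟨P, Q, hP, hQ, hP0, hQ0, hmem⟩ := S.exists_synthesis
  have hrep : ∀ f ∈ opEigenspace (tubeOperator q N k a) lam, ∀ (w : GraphL2)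
      (u u' : ℤ → Fin 3 → ℝ → ℂ), IsRep f w u u' → ∀ n j,
      f (n, j) = u n 1 0 • P j + u (n + 1) 1 0 • Q j := by
    intro f hf w u u' hr n j
    obtain ⟨hk, hs⟩ := hr.isSolution hf
    obtain ⟨e1, e2⟩ := eigenfunction_representation hm hφ hF hk hs n j
    refine Lp.ext ?_
    filter_upwards [(hr n j).1, hP j, hQ j, Lp.coeFn_add (u n 1 0 • P j) (u (n + 1) 1 0 • Q j),
      Lp.coeFn_smul (u n 1 0) (P j), Lp.coeFn_smul (u (n + 1) 1 0) (Q j),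
      ae_restrict_mem measurableSet_Icc] with t h1 h2 h3 h4 h5 h6 ht
    rw [h1, h4, Pi.add_apply, h5, h6, Pi.smul_apply, Pi.smul_apply, h2, h3,
      (hs n j).eq_comb ht, e1, e2, smul_eq_mul, smul_eq_mul]
    ring
  have hnP : 0 < ‖P 0‖ := norm_pos_iff.2 hP0
  let Ψ : lp (fun _ : ℤ => ℂ) 2 →ₗ[ℂ] opEigenspace (tubeOperator q N k a) lam :=
    (cellSynthesis P Q : lp (fun _ : ℤ => ℂ) 2 →ₗ[ℂ] GraphL2).codRestrict _ hmem
  have hΨ : ∀ x, ((Ψ x : opEigenspace (tubeOperator q N k a) lam) : GraphL2) =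
    cellSynthesis P Q x := fun x => rfl
  have hbij : Function.Bijective Ψ := by
    refine ⟨fun x y hxy => cellSynthesis_injective hP0 hQ0 (congrArg Subtype.val hxy), ?_⟩
    rintro ⟨f, hf⟩
    obtain ⟨w, u, u', hr, -⟩ := mem_opEigenspace_iff.1 hf
    have hfr := hrep f hf w u u' hr
    -- Edge `(n,0)` of `f` is `u n 1 0 • P 0`, so the coefficient is at most `‖P 0‖⁻¹` times the
    -- norm of `f` on cell `n`.
    have hx : Memℓp (fun n => u n 1 0) 2 := by
      refine memℓp_gen ?_
      simp only [ENNReal.toReal_ofNat, Real.rpow_ofNat]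
      refine Summable.of_nonneg_of_le (fun n => sq_nonneg _) (fun n => ?_)
        ((summable_cellNorm_sq f).1.mul_left ((‖P 0‖⁻¹) ^ 2))
      rw [← mul_pow]
      refine pow_le_pow_left₀ (norm_nonneg _) ?_ 2
      have h1 := norm_le_cellNorm f n 0
      rw [hfr, hQ0, smul_zero, add_zero, norm_smul] at h1
      rw [inv_mul_eq_div, le_div_iff₀ hnP]
      exact h1
    refine ⟨⟨_, hx⟩, Subtype.ext ?_⟩
    rw [hΨ]
    ext ⟨n, j⟩ : 2
    exact (hfr n j).symm
  let e := LinearEquiv.ofBijective Ψ hbij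
  have he : ∀ x, ((e x : opEigenspace (tubeOperator q N k a) lam) : GraphL2) =
    cellSynthesis P Q x := fun x => rfl
  let Φ := (e.toContinuousLinearEquivOfBounds ‖cellSynthesis P Q‖ (‖P 0‖⁻¹)
    (fun x => (cellSynthesis P Q).le_opNorm x) (fun f => by
      rw [inv_mul_eq_div, le_div_iff₀ hnP, mul_comm]
      refine (norm_le_norm_cellSynthesis P Q hQ0 _).trans (le_of_eq ?_)
      rw [← he, LinearEquiv.apply_symm_apply, Submodule.coe_norm])).symm
  have hΦ : ∀ f, cellSynthesis P Q (Φ f) = f := fun f => by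
    rw [← he]
    exact congrArg Subtype.val (e.apply_symm_apply f)
  refine ⟨fun n => cellSynthesis P Q (lp.single 2 n 1), fun n m j => ?_, fun n => hmem _, Φ,
    fun f => ⟨?_, ?_⟩⟩
  · simp only [cellSynthesis_apply, lp.single_apply]
    rcases eq_or_ne m n with rfl | h1
    · have h2 : m + 1 ≠ m := by omega
      rw [Pi.single_eq_same, Pi.single_eq_of_ne h2, one_smul, zero_smul, add_zero]
      filter_upwards [hP j] with t ht
      rw [ht]
      fin_cases j <;> simp [hS, antiperiodicSolution, psiZero] <;> ring
    · rw [Pi.single_eq_of_ne h1, zero_smul, zero_add]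
      rcases eq_or_ne (m + 1) n with rfl | h2
      · rw [Pi.single_eq_same, one_smul]
        filter_upwards [hQ j] with t ht
        rw [ht]
        fin_cases j <;> simp [hS, antiperiodicSolution, psiZero, phase_neg] <;> ring
      · rw [Pi.single_eq_of_ne h2, zero_smul]
        filter_upwards [Lp.coeFn_zero ℂ 2 edgeMeasure] with t ht
        have h3 : m - n ≠ 0 := by omega
        have h4 : m - n ≠ -1 := by omega
        rw [ht]
        fin_cases j <;> simp [psiZero, h3, h4]
  -- The expansion is the image of the unit vector expansion in `ℓ²` under the bounded synthesis
  -- map, hence it converges unconditionally.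
  · have := (lp.hasSum_single (p := 2) (by norm_num) (Φ f)).mapL (cellSynthesis P Q)
    rw [hΦ] at this
    refine this.congr_fun fun n => ?_
    rw [← map_smul, ← lp.single_smul, smul_eq_mul, mul_one]
  · intro w u u' hr n
    obtain ⟨hk, hs⟩ := hr.isSolution f.2
    have h1 : Φ f n = u n 1 0 := by
      have h2 := hrep f f.2 w u u' hr n 0
      rw [← hΦ f, cellSynthesis_apply, hQ0, smul_zero, smul_zero, add_zero, add_zero] at h2
      exact smul_left_injective ℂ hP0 h2
    obtain ⟨e1, e2⟩ := eigenfunction_representation hm hφ hF hk hs n 0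
    simp only [antiperiodicSolution, Matrix.cons_val_zero, mul_zero, add_zero] at e1 e2
    rw [h1, e1, e2, mul_div_cancel_right₀ _ hC1, mul_div_cancel_right₀ _ hC2]
    exact ⟨rfl, rfl, rfl⟩

end Expansion

end ZigzagTube

end

theorem theorem1p3 (q : Potential) (N : ℕ) (hN : 1 ≤ N) (k : ℤ) (a : ℝ)
    (hc : Real.cos (a + Real.pi * k / N) = 0) :
    opSpectrum (tubeOperator q N k a) = infiniteEigenvalues (tubeOperator q N k a) ∧
    infiniteEigenvalues (tubeOperator q N k a) =
      dirichletSpectrum q ∪ (fun lam : ℝ => (lam : ℂ)) '' singularEnergies q ∧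
    ∀ lam : ℝ, lam ∈ singularEnergies q →
      phi q lam 1 ≠ 0 ∧ constOne q lam ≠ 0 ∧ constTwo q lam ≠ 0 ∧
      ∃ ψ : ℤ → GraphL2,
        (∀ n m j, ∀ᵐ t ∂edgeMeasure, ψ n (m, j) t = psiZero q a lam (m - n) j t) ∧
        (∀ n, ψ n ∈ opEigenspace (tubeOperator q N k a) lam) ∧
        ∃ Φ : opEigenspace (tubeOperator q N k a) lam ≃L[ℂ] lp (fun _ : ℤ => ℂ) 2,
          ∀ f : opEigenspace (tubeOperator q N k a) lam,
            HasSum (fun n => Φ f n • ψ n) (f : GraphL2) ∧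
            ∀ (w : GraphL2) (u u' : ℤ → Fin 3 → ℝ → ℂ), IsRep f w u u' →
              ∀ n, Φ f n = u n 1 0 ∧ Φ f n = u n 0 0 / constOne q lam ∧
                Φ f n = u' n 0 0 / constTwo q lam := by
  have hm := phase_mul_sPow hc
  have h1 := opSpectrum_subset (q := q) hm
  have h2 := subset_infiniteEigenvalues (q := q) hm
  have h3 := infiniteEigenvalues_subset_opSpectrum (tubeOperator q N k a)
  -- The three inclusions form a cycle, which gives both equalities.
  refine ⟨(h1.trans h2).antisymm h3, (h3.trans h1).antisymm h2, fun lam hlam => ?_⟩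
  have hF := (bigF_eq_neg_one_iff q lam).1 hlam
  obtain ⟨hφ, hC1, hC2⟩ := constants_ne_zero hF
  exact ⟨hφ, hC1, hC2, eigenspace_expansion hm hφ hC1 hC2 hF⟩
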